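/- Let $\mathcal A$ be a finite alphabet with the discrete topology, let $\sigma$ be the left shift on $\mathcal A^{\mathbb Z}$ (with the product topology), and call a closed $\sigma$-invariant set $X\subset\mathcal A^{\mathbb Z}$ a subshift. For a subshift $X$, let $c_X(n)$ be the number of words of length $n$ that occur in some point of $X$. A point $x$ is recurrent if every word occurring in $x$ occurs in $x$ at least twice (that is, at two different positions). A nonempty subshift $M$ is minimal if it is the orbit closure $\overline{\{\sigma^n(y):n\in\mathbb Z\}}$ of each of its points $y$; a proper minimal subsystem of $X$ is a minimal subshift $M\subsetneq X$. For integers $j\ge 2$ and $0\le i\le j$, let $S(j,i)$ be the class of all subshifts $X$ (over any finite alphabet) such that $X$ is the orbit closure of a recurrent point $x \in X$, and $X$ has exactly $j$ proper minimal subsystems, exactly $i$ of which are infinite sets. Theorem 1.1. Let $j\ge 2$ and $0\le i\le j$. For every $X\in S(j,i)$, 1. $\limsup_{n\to\infty}\big(c_X(n)-(j+i+1)n\big)=\infty$, and 2. $\liminf_{n\to\infty}\big(c_X(n)-(j+i)n\big)=\infty$. Moreover both bounds are sharp: for every nondecreasing unbounded $g:\mathbb N\to\mathbb N$, - there is $X\in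 S(j,i)$ for which $\limsup_{n\to\infty}\big(c_X(n)-((j+i+1)n+g(n))\big)<\infty$, and - there is $X\in S(j,i)$ for which $\liminf_{n\to\infty}\big(c_X(n)-((j+i)n+g(n))\big)<\infty$. -/

import Mathlib

open SymbolicDynamics.FullShift Filter

noncomputable section

namespace SubshiftComplexity

variable {A : Type*}

/-- The orbit closure of a bi-infinite sequence `x`, in the product topology on `ℤ → A`. -/
def orbitClosure [TopologicalSpace A] (x : ℤ → A) : Set (ℤ → A) :=
  closure (Set.range fun n : ℤ => shift n x)

/-- `x` is recurrent: every word `x i, …, x (i + n - 1)` occurring in `x` occurs in `x` at least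
twice, i.e. also at a position different from `i`. -/
def IsRecurrent (x : ℤ → A) : Prop :=
  ∀ (i : ℤ) (n : ℕ), ∃ i' : ℤ, i' ≠ i ∧ ∀ k : Fin n, x (i' + (k : ℕ)) = x (i + (k : ℕ))

variable [TopologicalSpace A]

/-- The words of length `n` that occur in some point of the subshift `X`. -/
def words (X : Subshift A ℤ) (n : ℕ) : Set (Fin n → A) :=
  {w | ∃ x ∈ X.carrier, ∃ i : ℤ, ∀ k : Fin n, w k = x (i + (k : ℕ))}

/-- The complexity function of `X`: the number of words of length `n` in `X`. -/
def complexity (X : Subshift A ℤ) (n : ℕ) : ℕ :=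
  (words X n).ncard

/-- A subshift is minimal if it is nonempty and is the orbit closure of each of its points. -/
def IsMinimalSubshift (X : Subshift A ℤ) : Prop :=
  X.carrier.Nonempty ∧ ∀ x ∈ X.carrier, X.carrier = orbitClosure x

/-- The set of proper minimal subsystems of `X`. -/
def properMinimalSubsystems (X : Subshift A ℤ) : Set (Subshift A ℤ) :=
  {M | M.carrier ⊂ X.carrier ∧ IsMinimalSubshift M}

/-- `X` is the orbit closure of a recurrent point, and has exactly `j` proper minimal subsystems,
exactly `i` of which are infinite. -/
structure InClass (j i : ℕ) (X : Subshift A ℤ) : Prop where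
  exists_recurrent : ∃ x ∈ X.carrier, IsRecurrent x ∧ X.carrier = orbitClosure x
  encard_minimal : (properMinimalSubsystems X).encard = j
  encard_infinite : {M ∈ properMinimalSubsystems X | M.carrier.Infinite}.encard = i

/-- `limsup (c_X(n) - f(n)) = ∞`, as an equality of extended real numbers. -/
def LimsupBound (X : Subshift A ℤ) (f : ℕ → ℝ) : Prop :=
  limsup (fun n : ℕ => (((complexity X n : ℝ) - f n : ℝ) : EReal)) atTop = ⊤

/-- `liminf (c_X(n) - f(n)) = ∞`, as an equality of extended real numbers. -/
def LiminfBound (X : Subshift A ℤ) (f : ℕ → ℝ) : Prop :=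
  liminf (fun n : ℕ => (((complexity X n : ℝ) - f n : ℝ) : EReal)) atTop = ⊤

end SubshiftComplexity

end

noncomputable section

namespace SubshiftComplexity

variable {A : Type*}

/-! Lower bounds. For large `N`, distinct proper minimal subsystems share no word of length at least
`N`. Replace the recurrent point by its sequence of `(N + 1)`-blocks and colour a block by the
minimal subsystem whose language contains it, if any (`isColored_blockColor`). Words inside the
infinite minimal subsystems contribute at least `i * (n + 1)` by Morse–Hedlund, so it remains to
count non-monochromatic words, `b(n)` in number, and to show that `b(n) - j n` tends to infinity and
that `b(n) - (j + 1) n` is unbounded above.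

Passing from length `n` to `n + 1`, `b` grows by at least the number of non-monochromatic right
special words plus the number of exit words, monochromatic words followed by an uncoloured letter
(`ncard_badWords_succ`). Each of the `j` colours has an exit, and at infinitely many lengths an
uncoloured letter followed by a long run is right special. This settles the liminf.

For the limsup, call `n` deterministic if the colour of a run of length at least `n` determines what
follows it up to the end of the next monochromatic `n`-word. If large `n` are never deterministic,
the increments of `b` are eventually at least `j + 1`, and larger infinitely often. If `n` is
deterministic, the runs follow one another according to a permutation of the colours. Comparing how
far the pasts and futures of the exits agree produces `r` extra words between lengths `n` and `r +
1`, so `b(r + 1) - (j + 1)(r + 1) ≥ b(n) - j n - 1` (`exists_gt_of_isDeterministic`), and the right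
side tends to infinity.

Sharpness. Take `i` Sturmian sequences and `j - i` constant ones over disjoint alphabets, and build
a one-sided sequence from ever longer runs of them in cyclic order, copying the whole prefix built
so far after each cycle (`IsTower`). The run lengths make a run agree with both the right half and
the left half of its component, so a word shorter than the run sees only one junction. Counting
junctions gives `j n` at the end of a cycle and at most `(j + 1) n` otherwise, up to an error
controlled by the prefix before the run, which is kept below `g` by choosing the run long. One
construction serves both bounds. -/

/-- The word of length `n` occurring in `x` at position `p`. -/
def win (x : ℤ → A) (p : ℤ) (n : ℕ) : Fin n → A := fun k => x (p + (k : ℕ))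

theorem win_eq_win {x y : ℤ → A} {p q : ℤ} {n : ℕ} :
    win x p n = win y q n ↔ ∀ t : ℤ, 0 ≤ t → t < n → x (p + t) = y (q + t) := by
  constructor
  · intro h t h0 h1
    lift t to ℕ using h0
    exact congrFun h ⟨t, by exact_mod_cast h1⟩
  · intro h
    funext k
    exact h _ (by positivity) (by exact_mod_cast k.2)

/-! ### Partially coloured recurrent sequences: runs, entries and exits. -/

/-- The words of `x` at `p` and at `q` of length `n` agree. -/
def Agree (x : ℤ → A) (p q n : ℤ) : Prop := ∀ t : ℤ, 0 ≤ t → t < n → x (p + t) = x (q + t)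

/-- All letters of `x` in `[p, q)` have colour `k`. -/
def Mono {ι : Type*} (x : ℤ → A) (col : A → Option ι) (k : ι) (p q : ℤ) : Prop :=
  ∀ r, p ≤ r → r < q → col (x r) = some k

/-- Every colour-`k` run of `x` that covers `[p, p + n)` ends at `p + n`. -/
def IsExit {ι : Type*} (x : ℤ → A) (col : A → Option ι) (k : ι) (n : ℕ) (p : ℤ) : Prop :=
  Mono x col k p (p + n) ∧ col (x (p + n)) = none

/-- Recurrent sequences whose letters are partially coloured in such a way that
runs of a single colour are arbitrarily long and syndetic, and different colours are not
adjacent. -/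
structure IsColored {ι : Type*} (x : ℤ → A) (col : A → Option ι) : Prop where
  recur : ∀ (p : ℤ) (n D : ℕ), ∃ q q' : ℤ, q + D ≤ q' ∧ Agree x p q n ∧ Agree x p q' n
  adj : ∀ p k l, col (x p) = some k → col (x (p + 1)) = some l → k = l
  long : ∀ k (n : ℕ), ∃ p, Mono x col k p (p + n)
  synd : ∀ n : ℕ, ∃ R : ℕ, ∀ p : ℤ, ∃ q : ℤ, p ≤ q ∧ q ≤ p + R ∧ ∃ k, Mono x col k q (q + n)

theorem Agree.symm {x : ℤ → A} {p q n : ℤ} (h : Agree x p q n) : Agree x q p n :=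
  fun t h0 h1 => (h t h0 h1).symm

theorem Agree.trans {x : ℤ → A} {p q r n : ℤ} (h : Agree x p q n) (h' : Agree x q r n) :
    Agree x p r n :=
  fun t h0 h1 => (h t h0 h1).trans (h' t h0 h1)

theorem Agree.shift {x : ℤ → A} {p q n : ℤ} (h : Agree x p q n) {s m : ℤ} (hs : 0 ≤ s)
    (hm : s + m ≤ n) : Agree x (p + s) (q + s) m := by
  intro t h0 h1
  have := h (s + t) (by omega) (by omega)
  rwa [← add_assoc, ← add_assoc] at this

theorem Agree.mono {x : ℤ → A} {p q n : ℤ} (h : Agree x p q n) {m : ℤ}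
    (hm : m ≤ n) : Agree x p q m := fun t h0 h1 => h t h0 (by omega)

theorem Mono.agree {ι : Type*} {x : ℤ → A} {col : A → Option ι} {k : ι} {p q n : ℤ}
    (h : Mono x col k p (p + n)) (ha : Agree x p q n) :
    Mono x col k q (q + n) := by
  intro r h0 h1
  have := ha (r - q) (by omega) (by omega)
  rw [show q + (r - q) = r by omega] at this
  rw [← this]
  exact h _ (by omega) (by omega)

theorem Mono.sub {ι : Type*} {x : ℤ → A} {col : A → Option ι} {k : ι} {p q p' q' : ℤ}
    (h : Mono x col k p q) (hp : p ≤ p') (hq : q' ≤ q) :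
    Mono x col k p' q' := fun r h0 h1 => h r (by omega) (by omega)

namespace IsColored

variable {ι : Type*} {x : ℤ → A} {col : A → Option ι}

/-- Apply recurrence to one window containing both words. Its two distant occurrences allow either
word to be taken first. -/
theorem exists_ordered (h : IsColored x col) (p p' : ℤ) (n n' : ℕ) (D : ℕ) :
    ∃ q q' : ℤ, q + D ≤ q' ∧ Agree x p q n ∧ Agree x p' q' n' := by
  obtain ⟨a, ha⟩ : ∃ a, a = min p p' := ⟨_, rfl⟩
  obtain ⟨m, hm⟩ : ∃ m : ℕ, (m : ℤ) = max (p + n) (p' + n') - a :=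
    ⟨(max (p + n) (p' + n') - a).toNat, by omega⟩
  obtain ⟨q, q', hq, h1, h2⟩ := h.recur a m (D + m)
  refine ⟨q + (p - a), q' + (p' - a), by push_cast at hq; omega, ?_, ?_⟩
  · have := h1.shift (s := p - a) (m := n) (by omega) (by omega)
    rwa [show a + (p - a) = p by omega] at this
  · have := h2.shift (s := p' - a) (m := n') (by omega) (by omega)
    rwa [show a + (p' - a) = p' by omega] at this

theorem none_of_ne (h : IsColored x col) {k : ι} {p : ℤ} (h1 : col (x p) = some k)
    (h2 : col (x (p + 1)) ≠ some k) : col (x (p + 1)) = none := by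
  rcases hc : col (x (p + 1)) with _ | l
  · rfl
  · exact absurd (by rw [hc, h.adj p k l h1 hc]) h2

theorem none_of_ne' (h : IsColored x col) {k : ι} {p : ℤ} (h1 : col (x (p + 1)) = some k)
    (h2 : col (x p) ≠ some k) : col (x p) = none := by
  rcases hc : col (x p) with _ | l
  · rfl
  · exact absurd (by rw [hc, h.adj p l k hc h1]) h2

/-- The first position `≥ p` at which the colour is not `k`. -/
theorem exists_end {k : ι} {p q : ℤ} (hpq : p ≤ q) (hq : col (x q) ≠ some k) :
    ∃ r, p ≤ r ∧ r ≤ q ∧ Mono x col k p r ∧ col (x r) ≠ some k := by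
  classical
  have hex : ∃ t : ℕ, col (x (p + t)) ≠ some k := ⟨(q - p).toNat, by
    rwa [show p + ((q - p).toNat : ℤ) = q by omega]⟩
  refine ⟨p + Nat.find hex, by omega, ?_, ?_, Nat.find_spec hex⟩
  · have := Nat.find_min' hex (m := (q - p).toNat) (by
      rwa [show p + ((q - p).toNat : ℤ) = q by omega])
    omega
  · intro r h0 h1
    have := Nat.find_min hex (m := (r - p).toNat) (by omega)
    rw [show p + ((r - p).toNat : ℤ) = r by omega] at this
    exact not_not.1 this

/-- The last position `≤ p` at which the colour is not `k`. -/
theorem exists_start {k : ι} {p q : ℤ} (hpq : q ≤ p) (hq : col (x q) ≠ some k) :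
    ∃ r, q ≤ r ∧ r ≤ p ∧ Mono x col k (r + 1) (p + 1) ∧ col (x r) ≠ some k := by
  classical
  have hex : ∃ t : ℕ, col (x (p - t)) ≠ some k := ⟨(p - q).toNat, by
    rwa [show p - ((p - q).toNat : ℤ) = q by omega]⟩
  refine ⟨p - Nat.find hex, ?_, by omega, ?_, Nat.find_spec hex⟩
  · have := Nat.find_min' hex (m := (p - q).toNat) (by
      rwa [show p - ((p - q).toNat : ℤ) = q by omega])
    omega
  · intro r h0 h1
    have := Nat.find_min hex (m := (p - r).toNat) (by omega)
    rw [show p - ((p - r).toNat : ℤ) = r by omega] at this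
    exact not_not.1 this

/-- Recurrence places a letter of another colour on each side of a long `k`-run. The maximal `k`-run
in between is therefore bounded, and its neighbours are uncoloured since different colours are never
adjacent. -/
theorem exists_run_between (h : IsColored x col) [Nontrivial ι] (k : ι) (n : ℕ) :
    ∃ p q r : ℤ, p < q ∧ q + n ≤ r ∧ col (x p) = none ∧ Mono x col k (p + 1) r ∧
      p + 1 = q ∧ col (x r) = none := by
  obtain ⟨l, hl⟩ := exists_ne k
  obtain ⟨a, ha⟩ := h.long k (n + 1)
  obtain ⟨b, hb⟩ := h.long l 1
  obtain ⟨b1, a1, h1, hb1, ha1⟩ := h.exists_ordered b a 1 (n + 1) 1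
  obtain ⟨c, b2, h2, hc, hb2⟩ := h.exists_ordered b1 b (a1 - b1 + (n + 1)).toNat 1
    (a1 - b1 + (n + 1)).toNat
  have hcl : col (x c) = some l := by
    have e1 := hc 0 le_rfl (by omega)
    have e2 := hb1 0 le_rfl (by norm_num)
    simp only [add_zero] at e1 e2
    rw [← e1, ← e2]; exact hb b le_rfl (by norm_num)
  have hbl : col (x b2) = some l := by
    have e2 := hb2 0 le_rfl (by norm_num)
    simp only [add_zero] at e2
    rw [← e2]; exact hb b le_rfl (by norm_num)
  have hm : Mono x col k (c + (a1 - b1)) (c + (a1 - b1) + (n + 1 : ℕ)) := by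
    have := hc.shift (s := a1 - b1) (m := (n + 1 : ℕ)) (by omega) (by push_cast; omega)
    rw [show b1 + (a1 - b1) = a1 by omega] at this
    exact (ha.agree ha1).agree this
  have hl' : (some l : Option ι) ≠ some k := fun e => hl (Option.some.inj e)
  obtain ⟨p, hp1, hp2, hp3, hp4⟩ := exists_start (x := x) (col := col) (k := k) (p := c + (a1 - b1))
    (q := c) (by omega) (by rw [hcl]; exact hl')
  obtain ⟨r, hr1, hr2, hr3, hr4⟩ := exists_end (x := x) (col := col) (k := k) (p := c + (a1 - b1))
    (q := b2) (by omega) (by rw [hbl]; exact hl')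
  have hplt : p < c + (a1 - b1) := by
    rcases lt_or_eq_of_le hp2 with h | h
    · exact h
    · subst h; exact absurd (hm _ le_rfl (by push_cast; omega)) hp4
  have hrge : c + (a1 - b1) + (n + 1 : ℕ) ≤ r := by
    by_contra hlt
    exact hr4 (hm _ hr1 (by omega))
  push_cast at hrge
  refine ⟨p, p + 1, r, by omega, by omega, ?_, ?_, rfl, ?_⟩
  · exact h.none_of_ne' (hp3 (p + 1) le_rfl (by omega)) hp4
  · intro s h0 h1
    rcases lt_or_ge s (c + (a1 - b1)) with hs | hs
    · exact hp3 s h0 (by omega)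
    · exact hr3 s hs h1
  · have e : col (x (r - 1)) = some k := hr3 _ (by omega) (by omega)
    have := h.none_of_ne (p := r - 1) e (by rwa [sub_add_cancel])
    rwa [sub_add_cancel] at this

theorem exists_isExit (h : IsColored x col) [Nontrivial ι] (k : ι) (n : ℕ) :
    ∃ p, IsExit x col k n p := by
  obtain ⟨p, q, r, h1, h2, h3, h4, h5, h6⟩ := h.exists_run_between k n
  refine ⟨r - n, h4.sub (by omega) (by omega), ?_⟩
  rwa [sub_add_cancel]

/-- Arbitrarily long words consisting of one uncoloured letter followed by letters of
colour `k` are right special. -/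
theorem exists_special_entry (h : IsColored x col) [Nontrivial ι] [Finite A] (k : ι) (n₀ : ℕ) :
    ∃ n ≥ n₀, ∃ p p', Agree x p p' (n + 1) ∧ x (p + (n + 1)) ≠ x (p' + (n + 1)) ∧
      col (x p) = none ∧ Mono x col k (p + 1) (p + (n + 1)) := by
  by_contra hcon
  push Not at hcon
  choose p q r _ h2 h3 h4 h5 _ using h.exists_run_between k
  -- By pigeonhole, entries into arbitrarily long runs share their first `n₀ + 1` letters. This
  -- prefix occurs at two positions `a < a'`.
  obtain ⟨u, hu⟩ := Finite.exists_infinite_fiber (fun m : ℕ => win x (p m) (n₀ + 1))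
  have hinf : (((fun m : ℕ => win x (p m) (n₀ + 1)) ⁻¹' {u}) : Set ℕ).Infinite :=
    Set.infinite_coe_iff.1 hu
  obtain ⟨m₀, hm₀⟩ := hinf.nonempty
  obtain ⟨a, a', haa, ha, ha'⟩ := h.recur (p m₀) (n₀ + 1) 1
  obtain ⟨m, hm, hlt⟩ := hinf.exists_gt ((a' - a).toNat + n₀ + 1)
  have hmm : Agree x (p m) (p m₀) (n₀ + 1 : ℕ) := by
    have : win x (p m) (n₀ + 1) = win x (p m₀) (n₀ + 1) := by
      rw [Set.mem_preimage, Set.mem_singleton_iff] at hm hm₀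
      rw [hm, hm₀]
    exact win_eq_win.1 this
  -- Without right special entries, every occurrence of the prefix is forced to continue along the
  -- whole run. The one at `a` then reaches `a'`, whose letter is uncoloured.
  have hext : ∀ b, Agree x (p m) b (n₀ + 1) → ∀ t : ℕ, (t : ℤ) ≤ m - n₀ →
      Agree x (p m) b (n₀ + 1 + t) := by
    intro b hb t
    induction t with
    | zero => intro _; simpa using hb
    | succ t ih =>
      intro ht
      have iht := ih (by push_cast at ht; omega)
      intro s hs0 hs1
      rcases lt_or_ge s (n₀ + 1 + t) with hs | hs
      · exact iht s hs0 hs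
      · by_contra hne
        have hse : s = n₀ + t + 1 := by push_cast at hs1; omega
        subst hse
        have h2m := h2 m
        have h5m := h5 m
        refine hcon (n₀ + t) (by omega) (p m) b ?_ ?_ (h3 m) ?_
        · intro s' h0 h1; exact iht s' h0 (by push_cast at h1; omega)
        · push_cast; exact hne
        · exact (h4 m).sub le_rfl (by push_cast at ht ⊢; omega)
  have h2m := h2 m
  have h5m := h5 m
  have hA := hext a ((hmm.trans ha).mono (by push_cast; omega)) (m - n₀) (by omega)
  have hA' := hmm.trans ha' 0 le_rfl (by positivity)
  have h1 := hA (a' - a) (by omega) (by omega)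
  have hk := h4 m (p m + (a' - a)) (by omega) (by omega)
  rw [h1, show a + (a' - a) = a' by omega] at hk
  have hn := h3 m
  rw [add_zero, add_zero] at hA'
  rw [hA', hk] at hn
  simp at hn

end IsColored

theorem eventually_le_of_frequently_lt_succ {u : ℕ → ℤ} {n₀ : ℕ}
    (hmono : ∀ n ≥ n₀, u n ≤ u (n + 1)) (hstrict : ∀ m, ∃ n ≥ m, u n < u (n + 1)) (C : ℤ) :
    ∃ n₁, ∀ n ≥ n₁, C ≤ u n := by
  have hle : ∀ n m, n₀ ≤ n → n ≤ m → u n ≤ u m := by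
    intro n m hn hnm
    induction m, hnm using Nat.le_induction with
    | base => exact le_rfl
    | succ m hm ih => exact ih.trans (hmono m (hn.trans hm))
  have key : ∀ t : ℕ, ∃ n ≥ n₀, u n₀ + t ≤ u n := by
    intro t
    induction t with
    | zero => exact ⟨n₀, le_rfl, by simp⟩
    | succ t ih =>
      obtain ⟨n, hn, hu⟩ := ih
      obtain ⟨m, hm, hlt⟩ := hstrict n
      have := hle n m hn hm
      exact ⟨m + 1, by omega, by push_cast; omega⟩
  obtain ⟨n, hn, hu⟩ := key (C - u n₀).toNat
  exact ⟨n, fun m hm => by have := hle n m hn hm; omega⟩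

/-! ### Growth of the number of non-monochromatic words. -/

section Counting

variable {ι : Type*} (x : ℤ → A) (col : A → Option ι)

/-- The words of `x` of length `n` that are not monochromatic. -/
def badWords (n : ℕ) : Set (Fin n → A) :=
  {w | ∃ p, win x p n = w ∧ ¬ ∃ k, Mono x col k p (p + n)}

/-- The right special words of `x` of length `n` that are not monochromatic. -/
def specialWords (n : ℕ) : Set (Fin n → A) :=
  {w | ∃ p p', win x p n = w ∧ Agree x p p' n ∧ x (p + n) ≠ x (p' + n) ∧
    ¬ ∃ k, Mono x col k p (p + n)}

/-- The words of `x` consisting of `n` letters of one colour followed by an uncoloured letter. -/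
def exitWords (n : ℕ) : Set (Fin (n + 1) → A) :=
  {w | ∃ p k, win x p (n + 1) = w ∧ IsExit x col k n p}

end Counting

namespace IsColored

variable {ι : Type*} {x : ℤ → A} {col : A → Option ι}

theorem win_mem_specialWords_of_entry {n : ℕ} {p p' : ℤ} (h1 : Agree x p p' (n + 1))
    (h2 : x (p + (n + 1)) ≠ x (p' + (n + 1))) (h3 : col (x p) = none) :
    win x p (n + 1) ∈ specialWords x col (n + 1) := by
  refine ⟨p, p', rfl, by exact_mod_cast h1, by exact_mod_cast h2, ?_⟩
  rintro ⟨l, hl⟩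
  have := hl p le_rfl (by push_cast; omega)
  rw [h3] at this; simp at this

variable [Finite A]

/-- Every non-monochromatic word has a right extension, a right special one has a second, and exit
words are new because their prefixes of length `n` are monochromatic. The three families are
disjoint. -/
theorem ncard_badWords_succ {n : ℕ} (hn : 1 ≤ n) :
    (badWords x col n).ncard + (specialWords x col n).ncard + (exitWords x col n).ncard ≤
      (badWords x col (n + 1)).ncard := by
  classical
  have hsub : specialWords x col n ⊆ badWords x col n := by
    rintro w ⟨p, p', h1, -, -, h2⟩; exact ⟨p, h1, h2⟩
  have hpos : ∀ w : Fin n → A, ∃ p, w ∈ badWords x col n →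
      win x p n = w ∧ ¬ ∃ k, Mono x col k p (p + n) := by
    intro w
    by_cases hw : w ∈ badWords x col n
    · obtain ⟨p, hp⟩ := hw; exact ⟨p, fun _ => hp⟩
    · exact ⟨0, fun h => absurd h hw⟩
  choose P hP using hpos
  have hpos' : ∀ w : Fin n → A, ∃ p, w ∈ specialWords x col n →
      win x p n = w ∧ x (p + n) ≠ x (P w + n) := by
    intro w
    by_cases hw : w ∈ specialWords x col n
    · obtain ⟨p, p', h1, h2, h3, -⟩ := id hw
      by_cases e : x (p + n) = x (P w + n)
      · refine ⟨p', fun _ => ⟨?_, fun e' => h3 (e.trans e'.symm)⟩⟩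
        rw [← h1]; exact (win_eq_win.2 h2).symm
      · exact ⟨p, fun _ => ⟨h1, e⟩⟩
    · exact ⟨0, fun h => absurd h hw⟩
  choose Q hQ using hpos'
  have hprefix : ∀ p q, win x p (n + 1) = win x q (n + 1) → win x p n = win x q n := by
    intro p q h
    rw [win_eq_win] at h ⊢
    intro t h0 h1; exact h t h0 (by push_cast; omega)
  have hlast : ∀ p q, win x p (n + 1) = win x q (n + 1) → x (p + n) = x (q + n) := by
    intro p q h
    rw [win_eq_win] at h
    exact h n (by omega) (by push_cast; omega)
  have hbad : ∀ p, (¬ ∃ k, Mono x col k p (p + n)) → win x p (n + 1) ∈ badWords x col (n + 1) :=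
    fun p hp => ⟨p, rfl, fun ⟨k, hk⟩ => hp ⟨k, hk.sub le_rfl (by push_cast; omega)⟩⟩
  have hbadQ : ∀ w ∈ specialWords x col n, ¬ ∃ k, Mono x col k (Q w) (Q w + n) := by
    rintro w hw ⟨k, hk⟩
    refine (hP w (hsub hw)).2 ⟨k, hk.agree ?_⟩
    exact win_eq_win.1 ((hQ w hw).1.trans (hP w (hsub hw)).1.symm)
  set S1 := (fun w => win x (P w) (n + 1)) '' badWords x col n
  set S2 := (fun w => win x (Q w) (n + 1)) '' specialWords x col n
  have c1 : S1.ncard = (badWords x col n).ncard := by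
    apply Set.InjOn.ncard_image
    intro w hw w' hw' h
    rw [← (hP w hw).1, ← (hP w' hw').1]; exact hprefix _ _ h
  have c2 : S2.ncard = (specialWords x col n).ncard := by
    apply Set.InjOn.ncard_image
    intro w hw w' hw' h
    rw [← (hQ w hw).1, ← (hQ w' hw').1]; exact hprefix _ _ h
  have d12 : Disjoint S1 S2 := by
    rw [Set.disjoint_left]
    rintro _ ⟨w, hw, rfl⟩ ⟨w', hw', h⟩
    have e : w' = w := by
      rw [← (hQ w' hw').1, ← (hP w hw).1]; exact hprefix _ _ h
    subst e
    exact (hQ w' hw').2 (hlast _ _ h)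
  have hE : ∀ p, (¬ ∃ k, Mono x col k p (p + n)) → win x p (n + 1) ∉ exitWords x col n := by
    rintro p hp ⟨q, k, h, hq⟩
    exact hp ⟨k, hq.1.agree (win_eq_win.1 (hprefix _ _ h))⟩
  have d3 : Disjoint (S1 ∪ S2) (exitWords x col n) := by
    rw [Set.disjoint_left]
    rintro _ (⟨w, hw, rfl⟩ | ⟨w, hw, rfl⟩)
    · exact hE _ (hP w hw).2
    · exact hE _ (hbadQ w hw)
  rw [← c1, ← c2, ← Set.ncard_union_eq d12, ← Set.ncard_union_eq d3]
  refine Set.ncard_le_ncard ?_ (Set.toFinite _)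
  rintro _ ((⟨w, hw, rfl⟩ | ⟨w, hw, rfl⟩) | ⟨p, k, rfl, hp⟩)
  · exact hbad _ (hP w hw).2
  · exact hbad _ (hbadQ w hw)
  · refine ⟨p, rfl, ?_⟩
    rintro ⟨l, hl⟩
    have := hl (p + n) (by omega) (by push_cast; omega)
    rw [hp.2] at this; simp at this

/-- The first letter of an exit word reveals its colour, so each colour gives its own exit word, and
each colour in `S` a second one. -/
theorem card_add_le_ncard_exitWords (h : IsColored x col) [Nontrivial ι] [Fintype ι] {n : ℕ}
    (hn : 1 ≤ n) (S : Finset ι)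
    (hS : ∀ k ∈ S, ∃ p p', IsExit x col k n p ∧ IsExit x col k n p' ∧ ¬ Agree x p p' (n + 1)) :
    Fintype.card ι + S.card ≤ (exitWords x col n).ncard := by
  classical
  have hpos : ∀ k, ∃ p p', IsExit x col k n p ∧ IsExit x col k n p' ∧
      (k ∈ S → ¬ Agree x p p' (n + 1)) := by
    intro k
    by_cases hk : k ∈ S
    · obtain ⟨p, p', h1, h2, h3⟩ := hS k hk; exact ⟨p, p', h1, h2, fun _ => h3⟩
    · obtain ⟨p, hp⟩ := h.exists_isExit k n; exact ⟨p, p, hp, hp, fun h => absurd h hk⟩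
  choose P Q hP hQ hPQ using hpos
  have hcol : ∀ {k l : ι} {p q : ℤ}, IsExit x col k n p → IsExit x col l n q →
      win x p (n + 1) = win x q (n + 1) → k = l := by
    intro k l p q hp hq e
    have e0 := win_eq_win.1 e 0 le_rfl (by positivity)
    have e1 := hp.1 p le_rfl (by omega)
    have e2 := hq.1 q le_rfl (by omega)
    rw [add_zero, add_zero] at e0
    rw [e0, e2] at e1
    exact (Option.some.inj e1).symm
  have c1 : (Finset.univ.image fun k => win x (P k) (n + 1)).card = Fintype.card ι := by
    rw [Finset.card_image_of_injective, Finset.card_univ]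
    intro k l e; exact hcol (hP k) (hP l) e
  have c2 : (S.image fun k => win x (Q k) (n + 1)).card = S.card := by
    rw [Finset.card_image_of_injective]
    intro k l e; exact hcol (hQ k) (hQ l) e
  rw [← c1, ← c2, ← Finset.card_union_of_disjoint, ← Set.ncard_coe_finset]
  · refine Set.ncard_le_ncard ?_ (Set.toFinite _)
    intro w hw
    simp only [Finset.coe_union, Finset.coe_image, Finset.coe_univ, Set.image_univ,
      Set.mem_union, Set.mem_range, Set.mem_image] at hw
    rcases hw with ⟨k, rfl⟩ | ⟨k, -, rfl⟩
    · exact ⟨P k, k, rfl, hP k⟩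
    · exact ⟨Q k, k, rfl, hQ k⟩
  · rw [Finset.disjoint_left]
    intro w h1 h2
    simp only [Finset.mem_image, Finset.mem_univ, true_and] at h1 h2
    obtain ⟨k, rfl⟩ := h1
    obtain ⟨l, hl, e⟩ := h2
    have := hcol (hQ l) (hP k) e
    subst this
    refine hPQ l hl ?_
    have := win_eq_win.1 e
    intro t h0 h1; exact (this t h0 (by exact_mod_cast h1)).symm

/-- The colour of the last letter separates the special words attached to different `l`. -/
theorem card_le_ncard_specialWords {n : ℕ} (S : Finset ι)
    (hS : ∀ l ∈ S, ∃ p p', Agree x p p' n ∧ x (p + n) ≠ x (p' + n) ∧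
      (¬ ∃ k, Mono x col k p (p + n)) ∧ col (x (p + (n - 1))) = some l) (hn : 1 ≤ n) :
    S.card ≤ (specialWords x col n).ncard := by
  classical
  have hpos : ∀ l : S, ∃ p p', Agree x p p' n ∧ x (p + n) ≠ x (p' + n) ∧
      (¬ ∃ k, Mono x col k p (p + n)) ∧ col (x (p + (n - 1))) = some l.1 :=
    fun l => hS l l.2
  choose P Q h1 h2 h3 h4 using hpos
  have c : (Finset.univ.image fun l => win x (P l) n).card = S.card := by
    rw [Finset.card_image_of_injective, Finset.card_univ, Fintype.card_coe]
    intro k l e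
    have := win_eq_win.1 e (n - 1) (by omega) (by omega)
    have e1 := h4 k
    have e2 := h4 l
    rw [this, e2] at e1
    exact Subtype.ext (Option.some.inj e1).symm
  rw [← c, ← Set.ncard_coe_finset]
  refine Set.ncard_le_ncard ?_ (Set.toFinite _)
  intro w hw
  simp only [Finset.coe_image, Finset.coe_univ, Set.image_univ, Set.mem_range] at hw
  obtain ⟨l, rfl⟩ := hw
  exact ⟨P l, Q l, rfl, h1 l, h2 l, h3 l⟩

theorem card_le_ncard_exitWords (h : IsColored x col) [Nontrivial ι] [Fintype ι] {n : ℕ}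
    (hn : 1 ≤ n) : Fintype.card ι ≤ (exitWords x col n).ncard := by
  simpa using h.card_add_le_ncard_exitWords hn ∅ (by simp)

/-- The excess of the number of monochromatic-free words over `card ι * n` tends to infinity. -/
theorem eventually_le_ncard_badWords (h : IsColored x col) [Nontrivial ι] [Fintype ι] (C : ℤ) :
    ∃ n₁, ∀ n ≥ n₁, C + Fintype.card ι * n ≤ (badWords x col n).ncard := by
  obtain ⟨k⟩ : Nonempty ι := inferInstance
  obtain ⟨n₁, hn₁⟩ := eventually_le_of_frequently_lt_succ
    (u := fun n => ((badWords x col n).ncard : ℤ) - Fintype.card ι * n) (n₀ := 1) (by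
      intro n hn
      have h1 := ncard_badWords_succ (x := x) (col := col) hn
      have h2 := h.card_le_ncard_exitWords hn
      push_cast
      rw [mul_add, mul_one]
      omega) (by
      intro m
      obtain ⟨n, hn, p, p', e1, e2, e3, e4⟩ := h.exists_special_entry k m
      refine ⟨n + 1, by omega, ?_⟩
      have h1 := ncard_badWords_succ (x := x) (col := col) (n := n + 1) (by omega)
      have h2 := h.card_le_ncard_exitWords (n := n + 1) (by omega)
      have h3 : 0 < (specialWords x col (n + 1)).ncard :=
        (Set.ncard_pos).2 ⟨_, win_mem_specialWords_of_entry e1 e2 e3⟩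
      push_cast at h1 h2 h3 ⊢
      rw [mul_add, mul_add, mul_add, mul_one]
      omega) C
  exact ⟨n₁, fun n hn => by have := hn₁ n hn; omega⟩

end IsColored

/-! ### Deterministic and non-deterministic lengths. -/

/-- After leaving a run of colour `k` of length at least `n`, the sequence `x` always continues
in the same way until it completes the next monochromatic word of length `n`. -/
def IsDeterministic {ι : Type*} (x : ℤ → A) (col : A → Option ι) (n : ℕ) : Prop :=
  ∀ k p p', IsExit x col k n p → IsExit x col k n p' → ∀ t : ℤ, 0 ≤ t →
    (∀ q l, p < q → q + n ≤ p + t → ¬ Mono x col l q (q + n)) → x (p + t) = x (p' + t)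

namespace IsColored

variable {ι : Type*} {x : ℤ → A} {col : A → Option ι}

/-- Look at the first disagreement after two exits of the same colour. Within the first `n + 1`
letters it gives two exit words of one colour. Later it gives a right special word of length `n + 1`
that stays special and non-monochromatic when its first letter is dropped. -/
theorem exists_of_not_isDeterministic {n : ℕ} (h : ¬ IsDeterministic x col n) :
    (∃ k p p', IsExit x col k n p ∧ IsExit x col k n p' ∧ ¬ Agree x p p' (n + 1)) ∨
    ∃ p p', Agree x p p' (n + 1) ∧ x (p + (n + 1)) ≠ x (p' + (n + 1)) ∧
      ∀ l, ¬ Mono x col l (p + 1) (p + 1 + n) := by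
  classical
  unfold IsDeterministic at h
  push Not at h
  obtain ⟨k, p, p', hp, hp', t, ht, hno, hne⟩ := h
  lift t to ℕ using ht
  have hex : ∃ t : ℕ, x (p + t) ≠ x (p' + t) := ⟨t, hne⟩
  obtain ⟨s, hs⟩ : ∃ s, s = Nat.find hex := ⟨_, rfl⟩
  have hst : s ≤ t := hs ▸ Nat.find_min' hex hne
  have hsne : x (p + s) ≠ x (p' + s) := hs ▸ Nat.find_spec hex
  have hag : Agree x p p' s := by
    intro r h0 h1
    lift r to ℕ using h0
    have := Nat.find_min hex (m := r) (by omega)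
    exact not_not.1 this
  rcases le_or_gt s n with hsn | hsn
  · exact Or.inl ⟨k, p, p', hp, hp', fun hA => hsne (hA s (by omega) (by omega))⟩
  · refine Or.inr ⟨p + (s - (n + 1)), p' + (s - (n + 1)), hag.shift (by omega) (by omega), ?_, ?_⟩
    · rwa [add_assoc, add_assoc, sub_add_cancel]
    · intro l
      exact hno _ l (by omega) (by omega)

theorem mem_specialWords_of_tail {n : ℕ} {p p' : ℤ} (h1 : Agree x p p' (n + 1))
    (h2 : x (p + (n + 1)) ≠ x (p' + (n + 1))) (h3 : ∀ l, ¬ Mono x col l (p + 1) (p + 1 + n)) :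
    win x (p + 1) n ∈ specialWords x col n ∧ win x p (n + 1) ∈ specialWords x col (n + 1) := by
  constructor
  · refine ⟨p + 1, p' + 1, rfl, h1.shift (by omega) (by omega), ?_, fun ⟨l, hl⟩ => h3 l hl⟩
    rwa [add_assoc, add_assoc, add_comm (1 : ℤ)]
  · refine ⟨p, p', rfl, by exact_mod_cast h1, by exact_mod_cast h2, ?_⟩
    rintro ⟨l, hl⟩
    exact h3 l (hl.sub (by omega) (by push_cast; omega))

variable [Finite A]

theorem card_succ_le_of_not_isDeterministic (h : IsColored x col) [Nontrivial ι] [Fintype ι]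
    {n : ℕ} (hn : 1 ≤ n) (hdet : ¬ IsDeterministic x col n) :
    Fintype.card ι + 1 ≤ (specialWords x col n).ncard + (exitWords x col n).ncard := by
  rcases exists_of_not_isDeterministic hdet with ⟨k, hk⟩ | ⟨p, p', h1, h2, h3⟩
  · have := h.card_add_le_ncard_exitWords hn {k} (by simpa using hk)
    simp only [Finset.card_singleton] at this
    omega
  · have h4 := h.card_le_ncard_exitWords hn
    have h5 := (Set.ncard_pos).2 ⟨_, (mem_specialWords_of_tail h1 h2 h3).1⟩
    omega

/-- Between two lengths at which an entry into a run is right special, either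
some length is deterministic or the excess is at least two somewhere. -/
theorem exists_card_add_two_le (h : IsColored x col) [Nontrivial ι] [Fintype ι] {a b : ℕ}
    (ha : 1 ≤ a) (hab : a < b) {k : ι}
    (hspa : ∃ p p', Agree x p p' (a + 1) ∧ x (p + (a + 1)) ≠ x (p' + (a + 1)) ∧
      col (x p) = none ∧ Mono x col k (p + 1) (p + (a + 1)))
    (hspb : ∃ p p', Agree x p p' (b + 1) ∧ x (p + (b + 1)) ≠ x (p' + (b + 1)) ∧
      col (x p) = none ∧ Mono x col k (p + 1) (p + (b + 1)))
    (hdet : ∀ n, a + 1 ≤ n → n ≤ b → ¬ IsDeterministic x col n) :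
    ∃ n, a + 1 ≤ n ∧ n ≤ b + 1 ∧
      Fintype.card ι + 2 ≤ (specialWords x col n).ncard + (exitWords x col n).ncard := by
  by_contra hcon
  push Not at hcon
  -- If a special word is present, a second exit word would already give excess two, so the special
  -- word with non-monochromatic tail must occur. Its longer version is special at length `n + 1`,
  -- which propagates from `a + 1` to `b + 1`.
  have step : ∀ n, a + 1 ≤ n → n ≤ b → (specialWords x col n).Nonempty →
      ∃ p p', Agree x p p' (n + 1) ∧ x (p + (n + 1)) ≠ x (p' + (n + 1)) ∧
        ∀ l, ¬ Mono x col l (p + 1) (p + 1 + n) := by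
    intro n hn1 hn2 hne
    rcases exists_of_not_isDeterministic (hdet n hn1 hn2) with ⟨k, hk⟩ | h'
    · exfalso
      have h1 := h.card_add_le_ncard_exitWords (n := n) (by omega) {k} (by simpa using hk)
      have h2 := (Set.ncard_pos).2 hne
      have h3 := hcon n hn1 (by omega)
      simp only [Finset.card_singleton] at h1
      omega
    · exact h'
  have hne : ∀ n, a + 1 ≤ n → n ≤ b → (specialWords x col n).Nonempty := by
    intro n hn
    induction n, hn using Nat.le_induction with
    | base =>
      intro _
      obtain ⟨p, p', e1, e2, e3, -⟩ := hspa
      exact ⟨_, win_mem_specialWords_of_entry e1 e2 e3⟩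
    | succ n hn ih =>
      intro hb
      obtain ⟨p, p', h1, h2, h3⟩ := step n hn (by omega) (ih (by omega))
      exact ⟨_, (mem_specialWords_of_tail h1 h2 h3).2⟩
  obtain ⟨p, p', h1, h2, h3⟩ := step b (by omega) le_rfl (hne b (by omega) le_rfl)
  obtain ⟨q, q', e1, e2, e3, e4⟩ := hspb
  -- At length `b + 1` the propagated word has a non-monochromatic tail while the entry word has a
  -- monochromatic one, so they are two different special words.
  have hne : win x p (b + 1) ≠ win x q (b + 1) := by
    intro e
    refine h3 k ?_
    have hA : Agree x q p (b + 1) := by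
      have := win_eq_win.1 e.symm
      exact_mod_cast this
    have := hA.shift (s := 1) (m := b) (by omega) (by omega)
    exact Mono.agree (p := q + 1) (e4.sub le_rfl (by omega)) this
  have h4 := (Set.one_lt_ncard (Set.toFinite _)).2 ⟨_, (mem_specialWords_of_tail h1 h2 h3).2, _,
    win_mem_specialWords_of_entry e1 e2 e3, hne⟩
  have h5 := h.card_le_ncard_exitWords (n := b + 1) (by omega)
  have h6 := hcon (b + 1) (by omega) le_rfl
  omega

theorem eventually_le_of_not_isDeterministic (h : IsColored x col) [Nontrivial ι] [Fintype ι]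
    {n₀ : ℕ} (hdet : ∀ n ≥ n₀, ¬ IsDeterministic x col n) (C : ℤ) :
    ∃ n₁, ∀ n ≥ n₁, C + (Fintype.card ι + 1) * n ≤ (badWords x col n).ncard := by
  obtain ⟨k⟩ : Nonempty ι := inferInstance
  obtain ⟨n₁, hn₁⟩ := eventually_le_of_frequently_lt_succ
    (u := fun n => ((badWords x col n).ncard : ℤ) - (Fintype.card ι + 1) * n) (n₀ := n₀ + 1) (by
      intro n hn
      have h1 := ncard_badWords_succ (x := x) (col := col) (n := n) (by omega)
      have h2 := h.card_succ_le_of_not_isDeterministic (n := n) (by omega) (hdet n (by omega))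
      push_cast
      rw [mul_add, mul_one]
      omega) (by
      intro m
      obtain ⟨a, ha, hspa⟩ := h.exists_special_entry k (m + n₀ + 1)
      obtain ⟨b, hb, hspb⟩ := h.exists_special_entry k (a + 1)
      obtain ⟨n, hn1, hn2, hn3⟩ := h.exists_card_add_two_le (by omega) (by omega) hspa hspb
        (fun n h1 _ => hdet n (by omega))
      refine ⟨n, by omega, ?_⟩
      have h1 := ncard_badWords_succ (x := x) (col := col) (n := n) (by omega)
      push_cast
      rw [mul_add, mul_one]
      omega) C
  exact ⟨n₁, fun n hn => by have := hn₁ n hn; omega⟩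

end IsColored

/-! ### Transitions between colours at a deterministic length. -/

/-- For every colour `l`, a position `a l` at which a run of colour `prev l ≠ l` ends and after
which the next monochromatic word of length `n`, at distance `n + ρ l`, has colour `l`. -/
structure IsTransition {ι : Type*} (x : ℤ → A) (col : A → Option ι) (n : ℕ) (prev : ι → ι)
    (a : ι → ℤ) (ρ : ι → ℕ) : Prop where
  exit : ∀ l, IsExit x col (prev l) n (a l)
  pos : ∀ l, 1 ≤ ρ l
  ne : ∀ l, prev l ≠ l
  not_mono : ∀ l q k, a l < q → q < a l + (n + ρ l) → ¬ Mono x col k q (q + n)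
  mono : ∀ l, Mono x col l (a l + (n + ρ l)) (a l + (n + ρ l) + n)

namespace IsColored

variable {ι : Type*} {x : ℤ → A} {col : A → Option ι}

/-- If the run at `a` went on past `a + n`, a monochromatic `n`-word would start at `a + 1`: before
`b` this is excluded, and at `b` it contradicts `hne`. -/
theorem isExit_of_isolated (h : IsColored x col) {n : ℕ} (hn : 1 ≤ n) {k l : ι} {a b : ℤ}
    (hab : a < b) (ha : Mono x col k a (a + n)) (hb : Mono x col l b (b + n))
    (hne : k ≠ l ∨ col (x (b - 1)) ≠ some l)
    (hno : ∀ q m, a < q → q < b → ¬ Mono x col m q (q + n)) : IsExit x col k n a := by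
  refine ⟨ha, ?_⟩
  have := h.none_of_ne (p := a + n - 1) (k := k) (ha _ (by omega) (by omega))
  rw [sub_add_cancel] at this
  refine this fun hc => ?_
  have hm : Mono x col k (a + 1) (a + 1 + n) := by
    intro r h0 h1
    rcases lt_or_ge r (a + n) with hr | hr
    · exact ha r (by omega) hr
    · rwa [show r = a + n by omega]
  rcases lt_or_ge (a + 1) b with hlt | hge
  · exact hno _ k (by omega) hlt hm
  · have e : b = a + 1 := by omega
    subst e
    have e1 := hm (a + 1) le_rfl (by omega)
    rw [hb (a + 1) le_rfl (by omega)] at e1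
    have e2 := Option.some.inj e1
    subst e2
    rcases hne with hne | hne
    · exact hne rfl
    · rw [add_sub_cancel_right] at hne
      exact hne (ha a le_rfl (by omega))

theorem add_le_of_isExit {n : ℕ} {k l : ι} {a b : ℤ} (hab : a < b)
    (ha : IsExit x col k n a) (hb : Mono x col l b (b + n)) : a + n + 1 ≤ b := by
  by_contra hlt
  have := hb (a + n) (by omega) (by omega)
  rw [ha.2] at this
  simp at this

/-- Among all pairs of a monochromatic `n`-word of another colour and a later one of colour `l`,
take one at minimal distance. A monochromatic `n`-word in between would give a closer pair. -/
theorem exists_transition (h : IsColored x col) [Nontrivial ι] {n : ℕ} (hn : 1 ≤ n) (l : ι) :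
    ∃ k a b, k ≠ l ∧ a < b ∧ IsExit x col k n a ∧ Mono x col l b (b + n) ∧
      ∀ q m, a < q → q < b → ¬ Mono x col m q (q + n) := by
  classical
  obtain ⟨k₀, hk₀⟩ := exists_ne l
  obtain ⟨a₀, ha₀⟩ := h.long k₀ n
  obtain ⟨b₀, hb₀⟩ := h.long l n
  obtain ⟨a₁, b₁, hab, ha₁, hb₁⟩ := h.exists_ordered a₀ b₀ n n 1
  have hex : ∃ d : ℕ, ∃ a k, k ≠ l ∧ Mono x col k a (a + n) ∧ Mono x col l (a + d) (a + d + n) := by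
    refine ⟨(b₁ - a₁).toNat, a₁, k₀, hk₀, ha₀.agree ha₁, ?_⟩
    rw [show a₁ + ((b₁ - a₁).toNat : ℤ) = b₁ by omega]
    exact hb₀.agree hb₁
  obtain ⟨a, k, hk, ha, hb⟩ := Nat.find_spec hex
  have hmin := fun m => Nat.find_min hex (m := m)
  set d := Nat.find hex
  have hd : 0 < d := by
    rcases Nat.eq_zero_or_pos d with h0 | h0
    · exfalso
      rw [h0] at hb
      have e1 := ha a le_rfl (by omega)
      rw [hb a (by simp) (by push_cast; omega)] at e1
      exact hk (Option.some.inj e1).symm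
    · exact h0
  have hno : ∀ q m, a < q → q < a + d → ¬ Mono x col m q (q + n) := by
    intro q m h0 h1 hm
    by_cases hml : m = l
    · subst hml
      refine hmin (q - a).toNat (by omega) ⟨a, k, hk, ha, ?_⟩
      rwa [show a + ((q - a).toNat : ℤ) = q by omega]
    · refine hmin (a + d - q).toNat (by omega) ⟨q, m, hml, hm, ?_⟩
      rwa [show q + ((a + d - q).toNat : ℤ) = a + d by omega]
  exact ⟨k, a, a + d, hk, by omega, h.isExit_of_isolated hn (by omega) ha hb (Or.inl hk) hno, hb,
    hno⟩

theorem exists_isTransition (h : IsColored x col) [Nontrivial ι] {n : ℕ} (hn : 1 ≤ n) :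
    ∃ prev a ρ, IsTransition x col n prev a ρ := by
  choose prev a b h1 h2 h3 h4 h5 using fun l => h.exists_transition hn l
  have hb : ∀ l, b l = a l + (n + ((b l - a l - n).toNat : ℕ)) := fun l => by
    have := add_le_of_isExit (h2 l) (h3 l) (h4 l)
    omega
  refine ⟨prev, a, fun l => (b l - a l - n).toNat, h3, fun l => ?_, h1, fun l q k => ?_,
    fun l => ?_⟩
  · have := add_le_of_isExit (h2 l) (h3 l) (h4 l)
    omega
  · rw [← hb]; exact h5 l q k
  · rw [← hb]; exact h4 l

/-- An entry into a run is preceded by the end of another run, with no long run in between. -/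
theorem exists_exit_before (h : IsColored x col) {n : ℕ} (hn : 1 ≤ n) {l : ι} {q : ℤ}
    (hq : Mono x col l q (q + n)) (hq' : col (x (q - 1)) ≠ some l) :
    ∃ a k, a < q ∧ IsExit x col k n a ∧ ∀ r m, a < r → r < q → ¬ Mono x col m r (r + n) := by
  classical
  obtain ⟨R, hR⟩ := h.synd n
  have hex : ∃ t : ℕ, ∃ k, Mono x col k (q - 1 - t) (q - 1 - t + n) := by
    obtain ⟨r, h1, h2, k, hk⟩ := hR (q - 1 - R)
    refine ⟨(q - 1 - r).toNat, k, ?_⟩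
    rwa [show q - 1 - ((q - 1 - r).toNat : ℤ) = r by omega]
  obtain ⟨k, hk⟩ := Nat.find_spec hex
  have hmin := fun m => Nat.find_min hex (m := m)
  set t := Nat.find hex
  have hno : ∀ r m, q - 1 - t < r → r < q → ¬ Mono x col m r (r + n) := by
    intro r m h0 h1 hm
    refine hmin (q - 1 - r).toNat (by omega) ⟨m, ?_⟩
    rwa [show q - 1 - ((q - 1 - r).toNat : ℤ) = r by omega]
  exact ⟨q - 1 - t, k, by omega, h.isExit_of_isolated hn (by omega) hk hq (Or.inr hq') hno, hno⟩

end IsColored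

namespace IsTransition

variable {ι : Type*} {x : ℤ → A} {col : A → Option ι} {n : ℕ} {prev : ι → ι} {a : ι → ℤ}
  {ρ : ι → ℕ}

section

variable (H : IsTransition x col n prev a ρ) (hdet : IsDeterministic x col n)

include H hdet

theorem agree {l : ι} {p : ℤ} (hp : IsExit x col (prev l) n p) :
    Agree x (a l) p (n + ρ l + n) := by
  intro t h0 h1
  refine hdet _ _ _ (H.exit l) hp t h0 fun q k hq1 hq2 => ?_
  exact H.not_mono l q k hq1 (by omega)

theorem not_mono' {l : ι} {p : ℤ} (hp : IsExit x col (prev l) n p) {q : ℤ} {k : ι} (h1 : p < q)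
    (h2 : q < p + (n + ρ l)) : ¬ Mono x col k q (q + n) := by
  intro hm
  have hA := (H.agree hdet hp).symm.shift (s := q - p) (m := n) (by omega) (by omega)
  rw [show p + (q - p) = q by omega] at hA
  exact H.not_mono l _ k (by omega) (by omega) (hm.agree hA)

theorem mono' {l : ι} {p : ℤ} (hp : IsExit x col (prev l) n p) :
    Mono x col l (p + (n + ρ l)) (p + (n + ρ l) + n) :=
  (H.mono l).agree ((H.agree hdet hp).shift (by omega) (by omega))

theorem eq_of_isExit (hn : 1 ≤ n) {l l' : ι} {p q : ℤ} (hp : IsExit x col (prev l) n p)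
    (hpq : p < q) (hq : Mono x col l' q (q + n))
    (hno : ∀ r m, p < r → r < q → ¬ Mono x col m r (r + n)) : q = p + (n + ρ l) ∧ l = l' := by
  have h1 := H.mono' hdet hp
  have e : q = p + (n + ρ l) := by
    rcases lt_trichotomy q (p + (n + ρ l)) with h | h | h
    · exact absurd hq (H.not_mono' hdet hp hpq h)
    · exact h
    · exact absurd h1 (hno _ l (by have := H.pos l; omega) h)
  refine ⟨e, ?_⟩
  subst e
  have e1 := h1 _ le_rfl (by omega)
  rw [hq _ le_rfl (by omega)] at e1
  exact (Option.some.inj e1).symm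

/-- By determinism, the colour of an exit fixes the colour of the next long run. With finitely many
colours `prev` is then a permutation. -/
theorem prev_injective (hn : 1 ≤ n) : Function.Injective prev := by
  intro l l' e
  refine (H.eq_of_isExit hdet hn (l := l) (p := a l') (e ▸ H.exit l') ?_ (H.mono l') ?_).2
  · have := H.pos l'; omega
  · exact fun r m => H.not_mono l' r m

/-- The last long run before the entry has some colour `prev l'` by surjectivity, and determinism
then identifies both `l'` and the distance. -/
theorem exists_of_entry (h : IsColored x col) [Finite ι] (hn : 1 ≤ n) {l : ι} {q : ℤ}
    (hq : Mono x col l q (q + n)) (hq' : col (x (q - 1)) ≠ some l) :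
    ∃ p, IsExit x col (prev l) n p ∧ q = p + (n + ρ l) := by
  obtain ⟨p, k, h1, h2, h3⟩ := h.exists_exit_before hn hq hq'
  obtain ⟨l', rfl⟩ := (Finite.injective_iff_surjective.1 (H.prev_injective hdet hn)) k
  obtain ⟨e1, rfl⟩ := H.eq_of_isExit hdet hn h2 h1 hq h3
  exact ⟨p, h2, e1⟩

/-- The common continuation of all exits of colour `prev l` is finite. -/
theorem exists_common_future (h : IsColored x col) (l : ι) : ∃ d : ℕ, n ≤ d ∧
    (∀ p, IsExit x col (prev l) n p → Agree x (a l) p (n + ρ l + d)) ∧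
    ∃ p, IsExit x col (prev l) n p ∧ x (a l + (n + ρ l + d)) ≠ x (p + (n + ρ l + d)) := by
  classical
  have hex : ∃ d : ℕ, ∃ p, IsExit x col (prev l) n p ∧
      x (a l + (n + ρ l + d)) ≠ x (p + (n + ρ l + d)) := by
    by_contra hcon
    push Not at hcon
    have hall : ∀ p, IsExit x col (prev l) n p → ∀ t : ℤ, 0 ≤ t → x (a l + t) = x (p + t) := by
      intro p hp t ht
      rcases lt_or_ge t (n + ρ l + n) with hlt | hge
      · exact H.agree hdet hp t ht hlt
      · have := hcon (t - (n + ρ l)).toNat p hp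
        rwa [show (n + ρ l + ((t - (n + ρ l)).toNat : ℕ) : ℤ) = t by omega] at this
    obtain ⟨p, p', hpp, hp, hp'⟩ := h.recur (a l) (n + 1) 1
    have hex : ∀ {p}, Agree x (a l) p (n + 1 : ℕ) → IsExit x col (prev l) n p := by
      intro p hp
      refine ⟨(H.exit l).1.agree (hp.mono (by push_cast; omega)), ?_⟩
      rw [← hp n (by omega) (by push_cast; omega)]
      exact (H.exit l).2
    -- If the futures of all exits agreed forever, `x` would have period `w = p' - p` to the right
    -- of `p`. The uncoloured letter after the exit would then recur with gap `w`, excluding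
    -- monochromatic words of length `w`.
    have hper : ∀ t : ℤ, 0 ≤ t → x (p + t) = x (p' + t) := fun t ht =>
      (hall p (hex hp) t ht).symm.trans (hall p' (hex hp') t ht)
    obtain ⟨w, hw⟩ : ∃ w : ℕ, (w : ℤ) = p' - p := ⟨(p' - p).toNat, by omega⟩
    have hw1 : 1 ≤ w := by omega
    have hnone : ∀ s : ℕ, col (x (p + n + (s * w : ℕ))) = none := by
      intro s
      induction s with
      | zero => simpa using (hex hp).2
      | succ s ih =>
        have := hper (n + (s * w : ℕ)) (by omega)
        rw [← ih, ← add_assoc] at *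
        rw [this]
        congr 2
        push_cast
        rw [add_mul, hw]
        ring
    obtain ⟨R, hR⟩ := h.synd w
    obtain ⟨q, hq, -, k, hk⟩ := hR (p + n)
    obtain ⟨c, hc⟩ : ∃ c : ℕ, (c : ℤ) = q - p - n := ⟨(q - p - n).toNat, by omega⟩
    have h1 := Nat.div_add_mod (c + w - 1) w
    have h2 := Nat.mod_lt (c + w - 1) hw1
    have h3 := hnone ((c + w - 1) / w)
    rw [mul_comm] at h1
    rw [hk _ (by omega) (by omega)] at h3
    simp at h3
  refine ⟨Nat.find hex, ?_, ?_, Nat.find_spec hex⟩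
  · obtain ⟨p, hp, hne⟩ := Nat.find_spec hex
    by_contra hlt
    exact hne (H.agree hdet hp _ (by omega) (by omega))
  · intro p hp t h0 h1
    rcases lt_or_ge t (n + ρ l + n) with hlt | hge
    · exact H.agree hdet hp t h0 hlt
    · have := Nat.find_min hex (m := (t - (n + ρ l)).toNat) (by omega)
      push Not at this
      have := this p hp
      rwa [show (n + ρ l + ((t - (n + ρ l)).toNat : ℕ) : ℤ) = t by omega] at this

/-- Colour `l` has runs longer than any given length, and each is entered after an exit of colour
`prev l`. The common future therefore agrees with such a run. -/
theorem mono_common_future (h : IsColored x col) [Finite ι] [Nontrivial ι] (hn : 1 ≤ n) {l : ι}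
    {d : ℕ} (hd : ∀ p, IsExit x col (prev l) n p → Agree x (a l) p (n + ρ l + d)) :
    Mono x col l (a l + (n + ρ l)) (a l + (n + ρ l) + d) := by
  by_contra hcon
  unfold Mono at hcon
  push Not at hcon
  obtain ⟨r, h0, h1, h2⟩ := hcon
  obtain ⟨s, hs⟩ : ∃ s : ℕ, (s : ℤ) = r - (a l + (n + ρ l)) := ⟨(r - (a l + (n + ρ l))).toNat,
    by omega⟩
  have hns : n ≤ s := by
    by_contra hlt
    exact h2 (H.mono l r h0 (by omega))
  obtain ⟨p, q, c, hpq, hqc, hp, hm, rfl, -⟩ := h.exists_run_between l (s + 1)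
  push_cast at hqc
  obtain ⟨b, hb, e⟩ := H.exists_of_entry hdet h hn (l := l) (q := p + 1)
    (hm.sub le_rfl (by omega)) (by simp [hp])
  have e1 := hd b hb (n + ρ l + s) (by omega) (by omega)
  rw [show a l + (n + ρ l + s : ℤ) = r by omega, ← add_assoc, ← e] at e1
  exact h2 (e1 ▸ hm _ (by omega) (by omega))

/-- The run ending at this exit, if it starts within reach, starts with the common future of length
`d`. So it has at least `d` letters. -/
theorem mono_past (h : IsColored x col) [Finite ι] [Nontrivial ι] (hn : 1 ≤ n) {l : ι}
    {d : ℕ} (hd : ∀ p, IsExit x col (prev l) n p → Agree x (a l) p (n + ρ l + d)) {p : ℤ}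
    (hp : IsExit x col l n p) : Mono x col l (p + n - d) (p + n) := by
  by_contra hcon
  unfold Mono at hcon
  push Not at hcon
  obtain ⟨r, h0, h1, h2⟩ := hcon
  have hrp : r < p := by
    by_contra hge
    exact h2 (hp.1 r (by omega) h1)
  obtain ⟨s, hs1, hs2, hs3, hs4⟩ := IsColored.exists_start hrp.le h2
  have hsp : s ≠ p := by
    rintro rfl
    exact hs4 (hp.1 s le_rfl (by omega))
  have hm : Mono x col l (s + 1) (p + n) := by
    intro t ht0 ht1
    rcases lt_or_ge t p with hlt | hge
    · exact hs3 t ht0 (by omega)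
    · exact hp.1 t hge ht1
  obtain ⟨b, hb, e⟩ := H.exists_of_entry hdet h hn (l := l) (q := s + 1)
    (hm.sub le_rfl (by omega)) (by simpa using hs4)
  have hf := (H.mono_common_future hdet h hn hd).agree ((hd b hb).shift (by omega) (by omega))
  rw [← e] at hf
  have hle : s + 1 + d ≤ p + n := by
    by_contra hlt
    have := hf (p + n) (by omega) (by omega)
    rw [hp.2] at this
    simp at this
  exact h2 (hm r (by omega) h1)

/-- Here `δ` is the length of the common past of the exits of colour `prev l`, measured back from
the end of the run and truncated at `d`. -/
theorem exists_common_past (l : ι) {d : ℕ} (hd : n ≤ d) : ∃ δ : ℕ, n ≤ δ ∧ δ ≤ d ∧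
    (∀ p, IsExit x col (prev l) n p → ∀ t : ℤ, 0 ≤ t → t < δ →
      x (a l + n - 1 - t) = x (p + n - 1 - t)) ∧
    (δ < d → ∃ p, IsExit x col (prev l) n p ∧ x (a l + n - 1 - δ) ≠ x (p + n - 1 - δ)) := by
  induction d, hd using Nat.le_induction with
  | base =>
    refine ⟨n, le_rfl, le_rfl, fun p hp t h0 h1 => ?_, fun h => absurd h (lt_irrefl _)⟩
    have := H.agree hdet hp (n - 1 - t) (by omega) (by omega)
    rwa [show a l + (n - 1 - t : ℤ) = a l + n - 1 - t by omega,
      show p + (n - 1 - t : ℤ) = p + n - 1 - t by omega] at this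
  | succ d hd ih =>
    obtain ⟨δ, h1, h2, h3, h4⟩ := ih
    by_cases hlt : δ < d
    · exact ⟨δ, h1, by omega, h3, fun _ => h4 hlt⟩
    · have e : δ = d := by omega
      subst e
      by_cases hex : ∃ p, IsExit x col (prev l) n p ∧ x (a l + n - 1 - δ) ≠ x (p + n - 1 - δ)
      · exact ⟨δ, h1, by omega, h3, fun _ => hex⟩
      · push Not at hex
        refine ⟨δ + 1, by omega, le_rfl, fun p hp t h0 hlt => ?_, fun h => absurd h (lt_irrefl _)⟩
        rcases lt_or_ge t δ with hs | hs
        · exact h3 p hp t h0 hs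
        · have : t = δ := by push_cast at hlt; omega
          subst this
          exact hex p hp

end

end IsTransition

/-! ### Counting over the lengths following a deterministic one. -/

theorem sum_card_filter_ge {ι : Type*} [Fintype ι] (lo hi : ι → ℕ) {n m : ℕ}
    (h1 : ∀ l, n ≤ lo l) (h2 : ∀ l, hi l ≤ m) :
    ∑ l, (hi l - lo l) ≤
      ∑ ν ∈ Finset.Ico n (m + 1), (Finset.univ.filter fun l => lo l < ν ∧ ν ≤ hi l).card := by
  simp_rw [Finset.card_filter]
  rw [Finset.sum_comm]
  refine Finset.sum_le_sum fun l _ => ?_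
  rw [← Finset.card_filter, ← Nat.card_Ioc]
  refine Finset.card_le_card fun ν hν => ?_
  have := h1 l
  have := h2 l
  simp only [Finset.mem_Ioc] at hν
  simp only [Finset.mem_filter, Finset.mem_Ico]
  omega

namespace IsColored

variable {ι : Type*} {x : ℤ → A} {col : A → Option ι} [Finite A]

theorem ncard_badWords_add_sum_le {n m : ℕ} (hn : 1 ≤ n) (hnm : n ≤ m) :
    (badWords x col n).ncard +
      ∑ ν ∈ Finset.Ico n m, ((specialWords x col ν).ncard + (exitWords x col ν).ncard) ≤
      (badWords x col m).ncard := by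
  induction m, hnm using Nat.le_induction with
  | base => simp
  | succ m hm ih =>
    rw [Finset.sum_Ico_succ_top hm]
    have := ncard_badWords_succ (x := x) (col := col) (n := m) (by omega)
    omega

/-- For each `l`, the lengths in `(δ l, d (prev l)]` have a second exit word and those in `(d l, d l
+ ρ l + δ l]` a special word. These intervals have total length `r = ∑ (d (prev l) + ρ l)`, since
the `δ l` cancel and `prev` is a permutation, and they all lie below `r`. The witness is `m = r +
1`. -/
theorem exists_gt_of_isDeterministic (h : IsColored x col) [Nontrivial ι] [Fintype ι] {n : ℕ}
    (hn : 1 ≤ n) (hdet : IsDeterministic x col n) :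
    ∃ m > n, ((badWords x col n).ncard : ℤ) - Fintype.card ι * n - 1 ≤
      (badWords x col m).ncard - (Fintype.card ι + 1) * m := by
  classical
  obtain ⟨prev, a, ρ, H⟩ := h.exists_isTransition hn
  choose d hnd hd hdne using H.exists_common_future hdet h
  have hmono : ∀ l, Mono x col l (a l + (n + ρ l)) (a l + (n + ρ l) + d l) :=
    fun l => H.mono_common_future hdet h hn (hd l)
  have hpast : ∀ l p, IsExit x col l n p → Mono x col l (p + n - d l) (p + n) :=
    fun l p hp => H.mono_past hdet h hn (hd l) hp
  choose δ hnδ hδd hδ hδne using fun l => H.exists_common_past hdet l (hnd (prev l))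
  have hinj := H.prev_injective hdet hn
  have hsurj := Finite.injective_iff_surjective.1 hinj
  obtain ⟨r, hr⟩ : ∃ r : ℕ, r = ∑ l, (d (prev l) + ρ l) := ⟨_, rfl⟩
  have hdr : ∀ l, d (prev l) + ρ l ≤ r := fun l => hr ▸
    Finset.single_le_sum (f := fun l => d (prev l) + ρ l) (fun _ _ => Nat.zero_le _)
      (Finset.mem_univ l)
  -- The terms of `l` and of its successor `l' ≠ l` in the sum already contain `d (prev l) ≥ δ l`,
  -- `ρ l` and `d (prev l') = d l`.
  have hdr2 : ∀ l, d l + (ρ l + δ l) ≤ r := by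
    intro l
    obtain ⟨l', hl'⟩ := hsurj l
    have hne : l' ≠ l := by
      rintro rfl
      exact H.ne _ hl'
    have h1 : ∑ m ∈ {l', l}, (d (prev m) + ρ m) ≤ r := hr ▸
      Finset.sum_le_sum_of_subset (Finset.subset_univ _)
    rw [Finset.sum_pair hne, hl'] at h1
    have := hδd l
    omega
  have hexc : ∀ ν, n ≤ ν → Fintype.card ι +
      (Finset.univ.filter fun l => δ l < ν ∧ ν ≤ d (prev l)).card +
      (Finset.univ.filter fun l => d l < ν ∧ ν ≤ d l + (ρ l + δ l)).card ≤
        (specialWords x col ν).ncard + (exitWords x col ν).ncard := by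
    intro ν hν
    have e1 := h.card_add_le_ncard_exitWords (n := ν) (by omega)
      ((Finset.univ.filter fun l => δ l < ν ∧ ν ≤ d (prev l)).image prev) (by
        intro k hk
        simp only [Finset.mem_image, Finset.mem_filter, Finset.mem_univ, true_and] at hk
        obtain ⟨l, ⟨h1, h2⟩, rfl⟩ := hk
        obtain ⟨p, hp, hne⟩ := hδne l (by omega)
        have hex : ∀ p, IsExit x col (prev l) n p → IsExit x col (prev l) ν (p + n - ν) := by
          intro p hp
          refine ⟨(hpast _ p hp).sub (by omega) (by omega), ?_⟩
          rw [sub_add_cancel]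
          exact hp.2
        refine ⟨a l + n - ν, p + n - ν, hex _ (H.exit l), hex _ hp, fun hA => hne ?_⟩
        have := hA (ν - 1 - δ l) (by omega) (by omega)
        rwa [show a l + n - ν + (ν - 1 - δ l : ℤ) = a l + n - 1 - δ l by omega,
          show p + n - ν + (ν - 1 - δ l : ℤ) = p + n - 1 - δ l by omega] at this)
    rw [Finset.card_image_of_injective _ hinj] at e1
    have e2 := card_le_ncard_specialWords (x := x) (col := col) (n := ν)
      (Finset.univ.filter fun l => d l < ν ∧ ν ≤ d l + (ρ l + δ l)) (by
        intro l hl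
        simp only [Finset.mem_filter, Finset.mem_univ, true_and] at hl
        obtain ⟨p, hp, hne⟩ := hdne l
        have hnd' := hnd l
        have hρ := H.pos l
        have hnδ' := hnδ l
        -- The special word ends where the common future ends. It may reach back over the connection
        -- and `δ l` letters of common past. As `ν > d l`, it contains the letter before the entry,
        -- so it is not monochromatic.
        refine ⟨a l + (n + ρ l + d l) - ν, p + (n + ρ l + d l) - ν, ?_, ?_, ?_, ?_⟩
        · intro t h0 h1
          rcases lt_or_ge (n + ρ l + d l - ν + t : ℤ) 0 with hneg | hpos
          · have := hδ l p hp (n - 1 - (n + ρ l + d l - ν + t)) (by omega) (by omega)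
            rwa [show a l + n - 1 - (n - 1 - (n + ρ l + d l - ν + t) : ℤ) =
                a l + (n + ρ l + d l) - ν + t by ring,
              show p + n - 1 - (n - 1 - (n + ρ l + d l - ν + t) : ℤ) =
                p + (n + ρ l + d l) - ν + t by ring] at this
          · have := hd l p hp _ hpos (by omega)
            rwa [show a l + (n + ρ l + d l - ν + t : ℤ) = a l + (n + ρ l + d l) - ν + t by ring,
              show p + (n + ρ l + d l - ν + t : ℤ) = p + (n + ρ l + d l) - ν + t by ring] at this
        · rwa [sub_add_cancel, sub_add_cancel]
        · rintro ⟨k, hk⟩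
          have e1 := hk (a l + (n + ρ l + d l) - 1) (by omega) (by omega)
          rw [hmono l _ (by omega) (by omega)] at e1
          have e2 := Option.some.inj e1
          subst e2
          exact H.not_mono l (a l + (n + ρ l) - 1) l (by omega) (by omega)
            (hk.sub (by omega) (by omega))
        · exact hmono l _ (by omega) (by omega)) (by omega)
    omega
  obtain ⟨l₀⟩ : Nonempty ι := inferInstance
  have hnr : n ≤ r := by have := hdr l₀; have := hnd (prev l₀); omega
  refine ⟨r + 1, by omega, ?_⟩
  have h1 := ncard_badWords_add_sum_le (x := x) (col := col) hn (m := r + 1) (by omega)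
  have h2 := Finset.sum_le_sum (fun ν (hν : ν ∈ Finset.Ico n (r + 1)) =>
    hexc ν (Finset.mem_Ico.1 hν).1)
  rw [Finset.sum_add_distrib, Finset.sum_add_distrib, Finset.sum_const, Nat.card_Ico] at h2
  have h3 := sum_card_filter_ge (fun l => δ l) (fun l => d (prev l)) (n := n) (m := r)
    hnδ (fun l => by have := hdr l; omega)
  have h4 := sum_card_filter_ge (fun l => d l) (fun l => d l + (ρ l + δ l)) (n := n) (m := r)
    hnd hdr2
  have h5 : ∑ l, (d (prev l) - δ l) + ∑ l, (d l + (ρ l + δ l) - d l) = r := by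
    rw [← Finset.sum_add_distrib, hr]
    refine Finset.sum_congr rfl fun l _ => ?_
    have := hδd l
    omega
  have h6 : (r + 1 - n) • Fintype.card ι + r + (badWords x col n).ncard ≤
      (badWords x col (r + 1)).ncard := by omega
  zify [show n ≤ r + 1 by omega] at h6
  rw [smul_eq_mul] at h6
  push_cast [show n ≤ r + 1 by omega] at h6 ⊢
  linarith

/-- The number of non-monochromatic words of length `n` exceeds `(card ι + 1) * n` by
arbitrarily large amounts. -/
theorem frequently_le_ncard_badWords (h : IsColored x col) [Nontrivial ι] [Fintype ι] (C : ℤ)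
    (n₀ : ℕ) : ∃ n ≥ n₀, C + (Fintype.card ι + 1) * n ≤ (badWords x col n).ncard := by
  by_cases hdet : ∃ n₁, ∀ n ≥ n₁, ¬ IsDeterministic x col n
  · obtain ⟨n₁, hn₁⟩ := hdet
    obtain ⟨n₂, hn₂⟩ := h.eventually_le_of_not_isDeterministic hn₁ C
    exact ⟨max n₀ n₂, le_max_left _ _, hn₂ _ (le_max_right _ _)⟩
  · push Not at hdet
    obtain ⟨n₁, hn₁⟩ := h.eventually_le_ncard_badWords (C + 1)
    obtain ⟨n, hn, hd⟩ := hdet (max (max n₀ n₁) 1)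
    obtain ⟨m, hm, hle⟩ := h.exists_gt_of_isDeterministic (n := n) (by omega) hd
    have := hn₁ n (by omega)
    exact ⟨m, by omega, by linarith⟩

end IsColored

/-! ### Languages, orbit closures and minimal subshifts. -/

theorem win_shift (g : ℤ) (x : ℤ → A) (i : ℤ) (n : ℕ) : win (shift g x) i n = win x (g + i) n := by
  funext k
  simp only [win, shift_apply]
  congr 1; ring

theorem subshift_ext [TopologicalSpace A] {X Y : Subshift A ℤ} (h : X.carrier = Y.carrier) :
    X = Y := by
  cases X; cases Y; simp only at h; subst h; rfl

section Topology

variable [TopologicalSpace A]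

theorem mem_closure_of_forall_win {S : Set (ℤ → A)} {y : ℤ → A}
    (h : ∀ n : ℕ, ∃ z ∈ S, win z (-n) (2 * n + 1) = win y (-n) (2 * n + 1)) : y ∈ closure S := by
  rw [mem_closure_iff]
  intro U hU hyU
  obtain ⟨I, u, hu, hIU⟩ := isOpen_pi_iff.1 hU y hyU
  obtain ⟨n, hn⟩ : ∃ n : ℕ, ∀ j ∈ I, j.natAbs ≤ n :=
    ⟨I.sup Int.natAbs, fun j hj => Finset.le_sup (f := Int.natAbs) hj⟩
  obtain ⟨z, hz, hzy⟩ := h n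
  refine ⟨z, hIU fun j hj => ?_, hz⟩
  have := win_eq_win.1 hzy (j + n) (by have := hn j hj; omega)
    (by have := hn j hj; push_cast; omega)
  rw [show (-n + (j + n) : ℤ) = j by ring] at this
  rw [this]
  exact (hu j hj).2

theorem orbitClosure_subset {X : Subshift A ℤ} {y : ℤ → A} (hy : y ∈ X.carrier) :
    orbitClosure y ⊆ X.carrier := by
  refine closure_minimal ?_ X.isClosed
  rintro _ ⟨g, rfl⟩
  exact X.mapsTo g hy

theorem mem_words_iff {X : Subshift A ℤ} {n : ℕ} {w : Fin n → A} :
    w ∈ words X n ↔ ∃ y ∈ X.carrier, ∃ i, w = win y i n := by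
  simp only [words, Set.mem_ofPred_eq, win, funext_iff]

theorem win_mem_words {X : Subshift A ℤ} {y : ℤ → A} (hy : y ∈ X.carrier) (i : ℤ) (n : ℕ) :
    win y i n ∈ words X n := mem_words_iff.2 ⟨y, hy, i, rfl⟩

theorem mem_words_iff_exists_at {X : Subshift A ℤ} {n : ℕ} {w : Fin n → A} (i : ℤ) :
    w ∈ words X n ↔ ∃ y ∈ X.carrier, w = win y i n := by
  rw [mem_words_iff]
  constructor
  · rintro ⟨y, hy, i', rfl⟩
    exact ⟨shift (i' - i) y, X.mapsTo _ hy, by rw [win_shift, sub_add_cancel]⟩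
  · rintro ⟨y, hy, rfl⟩
    exact ⟨y, hy, i, rfl⟩

theorem words_mono {X Y : Subshift A ℤ} (h : X.carrier ⊆ Y.carrier) (n : ℕ) :
    words X n ⊆ words Y n := by
  rintro w ⟨y, hy, hw⟩
  exact ⟨y, h hy, hw⟩

theorem IsMinimalSubshift.eq_of_mem {M M' : Subshift A ℤ} (h : IsMinimalSubshift M)
    (h' : IsMinimalSubshift M') {y : ℤ → A} (hy : y ∈ M.carrier) (hy' : y ∈ M'.carrier) :
    M = M' := subshift_ext ((h.2 y hy).trans (h'.2 y hy').symm)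

theorem exists_mem_iInter [Finite A] (C : ℕ → Set (ℤ → A)) (hanti : ∀ n, C (n + 1) ⊆ C n)
    (hne : ∀ n, (C n).Nonempty) (hcl : ∀ n, IsClosed (C n)) : ∃ y, ∀ n, y ∈ C n := by
  obtain ⟨y, hy⟩ := IsCompact.nonempty_iInter_of_sequence_nonempty_isCompact_isClosed C hanti hne
    (hcl 0).isCompact hcl
  exact ⟨y, fun n => Set.mem_iInter.1 hy n⟩

/-- A point all of whose central words are words of the subshift belongs to it. -/
theorem mem_of_forall_win_mem_words {X : Subshift A ℤ} {y : ℤ → A}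
    (h : ∀ n : ℕ, win y (-n) (2 * n + 1) ∈ words X (2 * n + 1)) : y ∈ X.carrier := by
  rw [← X.isClosed.closure_eq]
  refine mem_closure_of_forall_win fun n => ?_
  obtain ⟨z, hz, e⟩ := (mem_words_iff_exists_at (-n : ℤ)).1 (h n)
  exact ⟨z, hz, e.symm⟩

theorem win_sub_mem_words {X : Subshift A ℤ} {y : ℤ → A} {i : ℤ} {n : ℕ}
    (h : win y i n ∈ words X n) {s m : ℕ} (hs : s + m ≤ n) : win y (i + s) m ∈ words X m := by
  obtain ⟨z, hz, e⟩ := (mem_words_iff_exists_at i).1 h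
  rw [show win y (i + s) m = win z (i + s) m from ?_]
  · exact win_mem_words hz _ _
  rw [win_eq_win] at e ⊢
  intro t h0 h1
  have := e (s + t) (by omega) (by omega)
  rwa [← add_assoc] at this

/-- The Morse–Hedlund theorem: an infinite subshift has more than `n` words of length `n`. -/
theorem lt_complexity_of_infinite [Finite A] {M : Subshift A ℤ} (hM : M.carrier.Infinite) (n : ℕ) :
    n + 1 ≤ complexity M n := by
  induction n with
  | zero =>
    obtain ⟨y, hy⟩ := hM.nonempty
    exact (Set.ncard_pos).2 ⟨_, win_mem_words hy 0 0⟩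
  | succ n ih =>
    by_contra hlt
    have hle : complexity M (n + 1) ≤ complexity M n := by omega
    -- If `c(n + 1) ≤ c(n)`, dropping the last letter (`s = 0`) and dropping the first (`s = 1`) are
    -- both injective on words. One `n`-word then determines the whole point, and the subshift is
    -- finite.
    have key : ∀ s : ℕ, s ≤ 1 → ∀ y ∈ M.carrier, ∀ z ∈ M.carrier, ∀ i,
        win y (i + s) n = win z (i + s) n → win y i (n + 1) = win z i (n + 1) := by
      intro s hs y hy z hz i e
      have himg : words M n ⊆ (fun (w : Fin (n + 1) → A) (k : Fin n) =>
          w ⟨k + s, by omega⟩) '' words M (n + 1) := by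
        intro w hw
        obtain ⟨u, hu, rfl⟩ := (mem_words_iff_exists_at (s : ℤ)).1 hw
        refine ⟨win u 0 (n + 1), win_mem_words hu _ _, ?_⟩
        funext k
        simp only [win]
        congr 1; push_cast; ring
      have hinj := Set.injOn_of_ncard_image_eq (s := words M (n + 1))
        (f := fun (w : Fin (n + 1) → A) (k : Fin n) => w ⟨k + s, by omega⟩)
        ((Set.ncard_image_le (Set.toFinite _)).antisymm
          (hle.trans (Set.ncard_le_ncard himg (Set.toFinite _)))) (Set.toFinite _)
      refine hinj (win_mem_words hy _ _) (win_mem_words hz _ _) ?_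
      funext k
      have := congrFun e k
      simp only [win] at this ⊢
      rw [show (i + ((k : ℕ) + s : ℕ) : ℤ) = i + s + (k : ℕ) by push_cast; ring]
      exact this
    have right : ∀ y ∈ M.carrier, ∀ z ∈ M.carrier, win y 0 n = win z 0 n →
        ∀ t : ℕ, win y t n = win z t n := by
      intro y hy z hz e t
      induction t with
      | zero => exact_mod_cast e
      | succ t ih =>
        have := win_eq_win.1 (key 0 (by omega) y hy z hz t (by simpa using ih))
        rw [win_eq_win]
        intro r h0 h1
        have := this (r + 1) (by omega) (by push_cast; omega)
        push_cast
        rwa [add_assoc, add_comm 1 r]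
    have left : ∀ y ∈ M.carrier, ∀ z ∈ M.carrier, win y 0 n = win z 0 n →
        ∀ t : ℕ, win y (-t) (n + 1) = win z (-t) (n + 1) := by
      intro y hy z hz e t
      induction t with
      | zero => exact key 0 (by omega) y hy z hz _ (by simpa using e)
      | succ t ih =>
        refine key 1 le_rfl y hy z hz _ ?_
        rw [win_eq_win] at ih ⊢
        intro r h0 h1
        have := ih r h0 (by push_cast; omega)
        push_cast
        rwa [show (-((t : ℤ) + 1) + 1 + r) = -t + r by ring]
    refine hM (Set.Finite.of_finite_image (f := fun y => win y 0 n) (Set.toFinite _) ?_)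
    intro y hy z hz e
    funext p
    rcases le_or_gt 0 p with hp | hp
    · lift p to ℕ using hp
      have := win_eq_win.1 (key 0 (by omega) y hy z hz p
        (by simpa using right y hy z hz e p)) 0 le_rfl (by positivity)
      simpa using this
    · have := win_eq_win.1 (left y hy z hz e (-p).toNat) 0 le_rfl (by positivity)
      rw [show (-((-p).toNat : ℤ) + 0) = p by omega] at this
      exact this

variable [DiscreteTopology A]

theorem isClosed_setOf_win [Finite A] (i : ℤ) (n : ℕ) (P : (Fin n → A) → Prop) :
    IsClosed {y : ℤ → A | P (win y i n)} := by
  have hc : Continuous fun y : ℤ → A => win y i n := by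
    unfold win
    fun_prop
  exact (isClosed_discrete {w | P w}).preimage hc

theorem exists_win_eq_of_mem_closure {S : Set (ℤ → A)} {y : ℤ → A} (hy : y ∈ closure S) (i : ℤ)
    (n : ℕ) : ∃ z ∈ S, win z i n = win y i n := by
  obtain ⟨z, hz, hzS⟩ := mem_closure_iff.1 hy _ (isOpen_cylinder (Finset.Ico i (i + n)) y)
    (fun _ _ => rfl)
  exact ⟨z, hzS, funext fun k => hz _ (by simp)⟩

theorem mem_orbitClosure_iff {x y : ℤ → A} :
    y ∈ orbitClosure x ↔ ∀ (i : ℤ) (n : ℕ), ∃ i', win y i n = win x i' n := by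
  constructor
  · intro h i n
    obtain ⟨_, ⟨g, rfl⟩, hz⟩ := exists_win_eq_of_mem_closure h i n
    exact ⟨g + i, by rw [← hz, win_shift]⟩
  · intro h
    refine mem_closure_of_forall_win fun n => ?_
    obtain ⟨i', hi'⟩ := h (-n) (2 * n + 1)
    exact ⟨_, ⟨i' + n, rfl⟩, by rw [win_shift, hi']; congr 1; ring⟩

theorem self_mem_orbitClosure (x : ℤ → A) : x ∈ orbitClosure x :=
  mem_orbitClosure_iff.2 fun i _ => ⟨i, rfl⟩

/-- The orbit closure of a point as a subshift. -/
def orbitSubshift (x : ℤ → A) : Subshift A ℤ where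
  carrier := orbitClosure x
  isClosed := isClosed_closure
  mapsTo := fun g y hy => by
    rw [mem_orbitClosure_iff] at hy ⊢
    intro i n
    rw [win_shift]
    exact hy _ _

theorem mem_words_orbit {X : Subshift A ℤ} {x : ℤ → A} (hx : X.carrier = orbitClosure x) {n : ℕ}
    {w : Fin n → A} : w ∈ words X n ↔ ∃ i, w = win x i n := by
  rw [mem_words_iff]
  constructor
  · rintro ⟨y, hy, i, rfl⟩
    rw [hx, mem_orbitClosure_iff] at hy
    exact hy i n
  · rintro ⟨i, rfl⟩
    exact ⟨x, hx ▸ self_mem_orbitClosure x, i, rfl⟩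

variable [Finite A]

theorem exists_isMinimalSubshift (X : Subshift A ℤ) (hX : X.carrier.Nonempty) :
    ∃ M : Subshift A ℤ, M.carrier ⊆ X.carrier ∧ IsMinimalSubshift M := by
  obtain ⟨m, hmX, hm⟩ := zorn_superset_nonempty
    {S : Set (ℤ → A) | S.Nonempty ∧ IsClosed S ∧ ∀ g, Set.MapsTo (shift g) S S} (by
      intro c hc hchain hne
      have := hne.to_subtype
      refine ⟨⋂₀ c, ⟨?_, isClosed_sInter fun s hs => (hc hs).2.1, ?_⟩, fun s hs =>
        Set.sInter_subset_of_mem hs⟩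
      · refine IsCompact.nonempty_sInter_of_directed_nonempty_isCompact_isClosed ?_
          (fun s hs => (hc hs).1) (fun s hs => (hc hs).2.1.isCompact) (fun s hs => (hc hs).2.1)
        intro s hs t ht
        rcases hchain.total hs ht with h | h
        · exact ⟨s, hs, subset_rfl, h⟩
        · exact ⟨t, ht, h, subset_rfl⟩
      · intro g y hy s hs
        exact (hc hs).2.2 g (hy s hs)) X.carrier ⟨hX, X.isClosed, X.mapsTo⟩
  refine ⟨⟨m, hm.1.2.1, hm.1.2.2⟩, hmX, hm.1.1, fun y hy => ?_⟩
  have hsub : orbitClosure y ⊆ m := orbitClosure_subset (X := ⟨m, hm.1.2.1, hm.1.2.2⟩) hy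
  exact (hm.2 (y := orbitClosure y) ⟨⟨y, self_mem_orbitClosure y⟩, isClosed_closure,
    (orbitSubshift y).mapsTo⟩ hsub).antisymm hsub

/-- If arbitrarily long words are common to two subshifts, so is some point. -/
theorem exists_mem_inter {X Y : Subshift A ℤ} (h : ∀ n, (words X n ∩ words Y n).Nonempty) :
    ∃ y, y ∈ X.carrier ∧ y ∈ Y.carrier := by
  obtain ⟨y, hy⟩ := exists_mem_iInter
    (fun n => X.carrier ∩ {y | win y (-n) (2 * n + 1) ∈ words Y (2 * n + 1)}) (by
      rintro n y ⟨h1, h2⟩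
      refine ⟨h1, ?_⟩
      have := win_sub_mem_words h2 (s := 1) (m := 2 * n + 1) (by omega)
      simpa using this) (by
      intro n
      obtain ⟨w, h1, h2⟩ := h (2 * n + 1)
      obtain ⟨y, hy, rfl⟩ := (mem_words_iff_exists_at (-n : ℤ)).1 h1
      exact ⟨y, hy, h2⟩) (fun n => X.isClosed.inter (isClosed_setOf_win _ _ _))
  exact ⟨y, (hy 0).1, mem_of_forall_win_mem_words fun n => (hy n).2⟩

theorem IsMinimalSubshift.exists_disjoint_words {M M' : Subshift A ℤ} (h : IsMinimalSubshift M)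
    (h' : IsMinimalSubshift M') (hne : M ≠ M') :
    ∃ n₀, ∀ n ≥ n₀, Disjoint (words M n) (words M' n) := by
  by_contra hcon
  push Not at hcon
  obtain ⟨y, h1, h2⟩ := exists_mem_inter (X := M) (Y := M') fun n => by
    obtain ⟨m, hm, hd⟩ := hcon n
    obtain ⟨w, hw, hw'⟩ := Set.not_disjoint_iff.1 hd
    obtain ⟨y, hy, rfl⟩ := (mem_words_iff_exists_at 0).1 hw
    have e := win_sub_mem_words hw (s := 0) (m := n) (by omega)
    have e' := win_sub_mem_words hw' (s := 0) (m := n) (by omega)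
    exact ⟨_, e, e'⟩
  exact hne (h.eq_of_mem h' h1 h2)

end Topology

/-! ### The colouring by minimal subsystems and the lower bounds. -/

theorem IsRecurrent.exists_agree {x : ℤ → A} (hx : IsRecurrent x) (p : ℤ) (n D : ℕ) :
    ∃ q q' : ℤ, q + D ≤ q' ∧ Agree x p q n ∧ Agree x p q' n := by
  induction D with
  | zero => exact ⟨p, p, by simp, fun _ _ _ => rfl, fun _ _ _ => rfl⟩
  | succ D ih =>
    obtain ⟨q, q', hq, h1, h2⟩ := ih
    -- Repeat the window spanning both occurrences. Its new copy lies strictly to one side, so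
    -- pairing an outer old occurrence with an outer new one increases the distance.
    obtain ⟨c, hc, hw⟩ := hx q ((q' - q).toNat + n)
    have hA : Agree x q c ((q' - q).toNat + n : ℕ) :=
      (win_eq_win (n := (q' - q).toNat + n)).1 (funext fun k => (hw k).symm)
    have hc1 : Agree x p c n := h1.trans (hA.mono (by push_cast; omega))
    have hc2 : Agree x p (c + (q' - q)) n := by
      have := hA.shift (s := q' - q) (m := n) (by omega) (by push_cast; omega)
      rw [show q + (q' - q) = q' by ring] at this
      exact h2.trans this
    rcases lt_or_gt_of_ne hc with hlt | hgt
    · exact ⟨c, q', by push_cast; omega, hc1, h2⟩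
    · exact ⟨q, c + (q' - q), by push_cast; omega, h1, hc2⟩

section Topology

variable [TopologicalSpace A]

/-- The partial colouring of words of length `N` by the minimal subsystem they belong to. -/
def blockColor (X : Subshift A ℤ) (N : ℕ) (w : Fin N → A) : Option (properMinimalSubsystems X) :=
  open Classical in
  if h : ∃ M : properMinimalSubsystems X, w ∈ words M.1 N then some h.choose else none

theorem blockColor_eq_some {X : Subshift A ℤ} {N : ℕ}
    (hN : ∀ M M' : properMinimalSubsystems X, M ≠ M' → Disjoint (words M.1 N) (words M'.1 N))
    {w : Fin N → A} {M : properMinimalSubsystems X} :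
    blockColor X N w = some M ↔ w ∈ words M.1 N := by
  unfold blockColor
  constructor
  · intro h
    split_ifs at h with hex
    rw [← Option.some.inj h]
    exact hex.choose_spec
  · intro hw
    have hex : ∃ M : properMinimalSubsystems X, w ∈ words M.1 N := ⟨M, hw⟩
    rw [dif_pos hex]
    congr 1
    by_contra hne
    exact Set.disjoint_left.1 (hN _ _ hne) hex.choose_spec hw

variable [DiscreteTopology A] [Finite A]

/-- Long words of a subshift with a proper minimal subsystem contain words of minimal
subsystems, at bounded distance. -/
theorem exists_syndetic {X : Subshift A ℤ} {x : ℤ → A} (hx : X.carrier = orbitClosure x)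
    (hne : (properMinimalSubsystems X).Nonempty) (n : ℕ) :
    ∃ R : ℕ, ∀ p : ℤ, ∃ q : ℤ, p ≤ q ∧ q ≤ p + R ∧
      ∃ M ∈ properMinimalSubsystems X, win x q n ∈ words M n := by
  by_contra hcon
  push Not at hcon
  -- By compactness, unbounded gaps give a point `y` of `X` with no word of length `n` from any
  -- proper minimal subsystem. This contradicts the minimal set inside its orbit closure.
  obtain ⟨y, hy⟩ := exists_mem_iInter
    (fun R => X.carrier ∩ {y | ∀ q : ℤ, -R ≤ q → q ≤ R → ∀ M ∈ properMinimalSubsystems X,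
      win y q n ∉ words M n}) (by
      rintro R y ⟨h1, h2⟩
      exact ⟨h1, fun q hq1 hq2 => h2 q (by push_cast; omega) (by push_cast; omega)⟩) (by
      intro R
      obtain ⟨p, hp⟩ := hcon (2 * R)
      refine ⟨shift (p + R) x, X.mapsTo _ (hx ▸ self_mem_orbitClosure x), fun q h1 h2 M hM => ?_⟩
      rw [win_shift]
      exact hp _ (by omega) (by push_cast; omega) M hM) (by
      intro R
      refine X.isClosed.inter ?_
      have : {y : ℤ → A | ∀ q : ℤ, -R ≤ q → q ≤ R → ∀ M ∈ properMinimalSubsystems X,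
          win y q n ∉ words M n} = ⋂ q : ℤ, {y : ℤ → A | -R ≤ q → q ≤ R →
            ∀ M ∈ properMinimalSubsystems X, win y q n ∉ words M n} := by
        ext y; simp
      rw [this]
      exact isClosed_iInter fun q => isClosed_setOf_win q n (fun w => -R ≤ q → q ≤ R →
            ∀ M ∈ properMinimalSubsystems X, w ∉ words M n))
  obtain ⟨M, hM, hmin⟩ := exists_isMinimalSubshift (orbitSubshift y) ⟨y, self_mem_orbitClosure y⟩
  have hMX : M.carrier ⊆ X.carrier := hM.trans (orbitClosure_subset (hy 0).1)
  have hMp : M ∈ properMinimalSubsystems X := by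
    -- Were `M` all of `X`, then `X` would be minimal and could not contain a proper minimal
    -- subsystem.
    refine ⟨⟨hMX, fun hXM => ?_⟩, hmin⟩
    obtain ⟨M', hM', hmin'⟩ := hne
    obtain ⟨z, hz⟩ := hmin'.1
    have := hmin.eq_of_mem hmin' (hXM (hM'.1 hz)) hz
    subst this
    exact hM'.2 hXM
  obtain ⟨z, hz⟩ := hmin.1
  obtain ⟨q, hq⟩ := mem_orbitClosure_iff.1 (hM hz) 0 n
  exact (hy q.natAbs).2 q (by omega) (by omega) M hMp (hq ▸ win_mem_words hz 0 n)

/-- Blocks have length `N + 1` so that consecutive ones overlap in a word of length `N`. Two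
adjacent colours would share that word and hence coincide. -/
theorem isColored_blockColor {X : Subshift A ℤ} {x : ℤ → A} (hrec : IsRecurrent x)
    (hx : X.carrier = orbitClosure x) (hne : (properMinimalSubsystems X).Nonempty) {N : ℕ}
    (hN : ∀ M M' : properMinimalSubsystems X, M ≠ M' → ∀ n ≥ N,
      Disjoint (words M.1 n) (words M'.1 n)) :
    IsColored (fun p => win x p (N + 1)) (blockColor X (N + 1)) := by
  have hcol : ∀ {w : Fin (N + 1) → A} {M}, blockColor X (N + 1) w = some M ↔
      w ∈ words M.1 (N + 1) :=
    blockColor_eq_some fun M M' h => hN M M' h (N + 1) (by omega)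
  have hmono : ∀ {p : ℤ} {n : ℕ} {M : properMinimalSubsystems X},
      win x p (n + (N + 1)) ∈ words M.1 (n + (N + 1)) →
      Mono (fun p => win x p (N + 1)) (blockColor X (N + 1)) M p (p + n) := by
    intro p n M h r h0 h1
    have := win_sub_mem_words h (s := (r - p).toNat) (m := N + 1) (by omega)
    rw [show p + ((r - p).toNat : ℤ) = r by omega] at this
    exact hcol.2 this
  refine ⟨fun p n D => ?_, fun p M M' h h' => ?_, fun M n => ?_, fun n => ?_⟩
  · obtain ⟨q, q', hq, h1, h2⟩ := hrec.exists_agree p (n + (N + 1)) D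
    have hag : ∀ {q}, Agree x p q (n + (N + 1) : ℕ) →
        Agree (fun p => win x p (N + 1)) p q n := by
      intro q h t h0 h1
      exact win_eq_win.2 (h.shift h0 (by push_cast; omega))
    exact ⟨q, q', hq, hag h1, hag h2⟩
  · by_contra hne
    have e := win_sub_mem_words (hcol.1 h) (s := 1) (m := N) (by omega)
    have e' := win_sub_mem_words (hcol.1 h') (s := 0) (m := N) (by omega)
    rw [Nat.cast_zero, add_zero] at e'
    exact Set.disjoint_left.1 (hN M M' hne N le_rfl) e e'
  · obtain ⟨z, hz⟩ := M.2.2.1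
    obtain ⟨p, hp⟩ := mem_orbitClosure_iff.1 (hx ▸ M.2.1.1 hz) 0 (n + (N + 1))
    exact ⟨p, hmono (hp ▸ win_mem_words hz 0 _)⟩
  · obtain ⟨R, hR⟩ := exists_syndetic hx hne (n + (N + 1))
    refine ⟨R, fun p => ?_⟩
    obtain ⟨q, h1, h2, M, hM, h3⟩ := hR p
    exact ⟨q, h1, h2, ⟨M, hM⟩, hmono h3⟩

/-- A word of `n` consecutive blocks is a word of length `n + N` of `x`. If it is not monochromatic,
it belongs to no minimal subsystem, while the languages of the infinite ones are disjoint and have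
at least `n + N + 1` words each. -/
theorem ncard_badWords_add_le {X : Subshift A ℤ} {x : ℤ → A}
    (hx : X.carrier = orbitClosure x) {N : ℕ} [Fintype (properMinimalSubsystems X)]
    (hN : ∀ M M' : properMinimalSubsystems X, M ≠ M' → ∀ n ≥ N,
      Disjoint (words M.1 n) (words M'.1 n)) (I : Finset (properMinimalSubsystems X))
    (hI : ∀ M ∈ I, M.1.carrier.Infinite) {n : ℕ} (hn : 1 ≤ n) :
    (badWords (fun p => win x p (N + 1)) (blockColor X (N + 1)) n).ncard +
      I.card * (n + N + 1) ≤ complexity X (n + N) := by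
  classical
  have hcol : ∀ {w : Fin (N + 1) → A} {M}, blockColor X (N + 1) w = some M ↔
      w ∈ words M.1 (N + 1) :=
    blockColor_eq_some fun M M' h => hN M M' h (N + 1) (by omega)
  set B := badWords (fun p => win x p (N + 1)) (blockColor X (N + 1)) n
  have hpos : ∀ w : Fin n → Fin (N + 1) → A, ∃ p : ℤ, w ∈ B →
      win (fun p => win x p (N + 1)) p n = w ∧ ¬ ∃ M, Mono (fun p => win x p (N + 1))
        (blockColor X (N + 1)) M p (p + n) := by
    intro w
    by_cases hw : w ∈ B
    · obtain ⟨p, hp⟩ := hw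
      exact ⟨p, fun _ => hp⟩
    · exact ⟨0, fun h => absurd h hw⟩
  choose P hP using hpos
  have c1 : ((fun w => win x (P w) (n + N)) '' B).ncard = B.ncard := by
    apply Set.InjOn.ncard_image
    intro w hw w' hw' h
    rw [← (hP w hw).1, ← (hP w' hw').1, win_eq_win]
    intro t h0 h1
    rw [win_eq_win]
    intro s h2 h3
    have := win_eq_win.1 h (t + s) (by omega) (by push_cast at *; omega)
    rwa [← add_assoc, ← add_assoc] at this
  have c2 : I.card * (n + N + 1) ≤
      (I.biUnion fun M => (Set.toFinite (words M.1 (n + N))).toFinset).card := by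
    rw [Finset.card_biUnion]
    · rw [← smul_eq_mul]
      refine Finset.card_nsmul_le_sum _ _ _ fun M hM => ?_
      rw [← Set.ncard_eq_toFinset_card]
      exact lt_complexity_of_infinite (hI M hM) _
    · intro M _ M' _ hne
      simpa using hN M M' hne (n + N) (by omega)
  rw [← c1]
  refine (Nat.add_le_add_left c2 _).trans ?_
  rw [← Set.ncard_coe_finset, ← Set.ncard_union_eq _ (Set.toFinite _) (Set.toFinite _)]
  · refine Set.ncard_le_ncard ?_ (Set.toFinite _)
    rintro w (⟨w, hw, rfl⟩ | hw)
    · exact (mem_words_orbit hx).2 ⟨_, rfl⟩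
    · simp only [Finset.coe_biUnion, Set.Finite.coe_toFinset, Set.mem_iUnion] at hw
      obtain ⟨M, -, hw⟩ := hw
      exact words_mono M.2.1.1 _ hw
  · rw [Set.disjoint_left]
    rintro _ ⟨w, hw, rfl⟩ h
    simp only [Finset.coe_biUnion, Set.Finite.coe_toFinset, Set.mem_iUnion] at h
    obtain ⟨M, -, h⟩ := h
    refine (hP w hw).2 ⟨M, fun r h0 h1 => hcol.2 ?_⟩
    have := win_sub_mem_words h (s := (r - P w).toNat) (m := N + 1) (by omega)
    rwa [show P w + ((r - P w).toNat : ℤ) = r by omega] at this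

theorem exists_disjoint_words_properMinimalSubsystems {X : Subshift A ℤ}
    [Fintype (properMinimalSubsystems X)] :
    ∃ N, ∀ M M' : properMinimalSubsystems X, M ≠ M' → ∀ n ≥ N,
      Disjoint (words M.1 n) (words M'.1 n) := by
  classical
  have : ∀ M M' : properMinimalSubsystems X, ∃ N, M ≠ M' → ∀ n ≥ N,
      Disjoint (words M.1 n) (words M'.1 n) := by
    intro M M'
    by_cases h : M = M'
    · exact ⟨0, fun h' => absurd h h'⟩
    · obtain ⟨N, hN⟩ := M.2.2.exists_disjoint_words M'.2.2 (fun e => h (Subtype.ext e))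
      exact ⟨N, fun _ => hN⟩
  choose F hF using this
  refine ⟨Finset.univ.sup fun M => Finset.univ.sup fun M' => F M M', fun M M' h n hn => ?_⟩
  refine hF M M' h n (le_trans ?_ hn)
  exact (Finset.le_sup (f := fun M' => F M M') (Finset.mem_univ M')).trans
    (Finset.le_sup (f := fun M => Finset.univ.sup fun M' => F M M') (Finset.mem_univ M))

theorem limsup_eq_top_of_frequently {u : ℕ → ℝ} (h : ∀ C : ℝ, ∃ᶠ n in atTop, C ≤ u n) :
    limsup (fun n => (u n : EReal)) atTop = ⊤ := by
  rw [EReal.eq_top_iff_forall_lt]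
  intro y
  refine lt_of_lt_of_le (b := ((y + 1 : ℝ) : EReal)) (by exact_mod_cast lt_add_one y) ?_
  exact le_limsup_of_frequently_le' ((h (y + 1)).mono fun n hn => by exact_mod_cast hn)

theorem liminf_eq_top_of_eventually {u : ℕ → ℝ} (h : ∀ C : ℝ, ∀ᶠ n in atTop, C ≤ u n) :
    liminf (fun n => (u n : EReal)) atTop = ⊤ := by
  rw [EReal.eq_top_iff_forall_lt]
  intro y
  refine lt_of_lt_of_le (b := ((y + 1 : ℝ) : EReal)) (by exact_mod_cast lt_add_one y) ?_
  exact le_liminf_of_le (h := (h (y + 1)).mono fun n hn => by exact_mod_cast hn)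

/-- The lower bounds on the complexity. -/
theorem InClass.limsupBound_and_liminfBound {X : Subshift A ℤ} {j i : ℕ} (hj : 2 ≤ j)
    (hX : InClass j i X) :
    LimsupBound X (fun n : ℕ => ((j : ℝ) + i + 1) * n) ∧
      LiminfBound X (fun n : ℕ => ((j : ℝ) + i) * n) := by
  classical
  obtain ⟨x, -, hrec, hx⟩ := hX.exists_recurrent
  have hfin : (properMinimalSubsystems X).Finite :=
    Set.finite_of_encard_eq_coe hX.encard_minimal
  have := hfin.fintype
  have hcard : Fintype.card (properMinimalSubsystems X) = j := by
    have := hX.encard_minimal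
    rw [← Set.coe_fintypeCard] at this
    exact_mod_cast this
  have : Nontrivial (properMinimalSubsystems X) := Fintype.one_lt_card_iff_nontrivial.1 (by omega)
  obtain ⟨I, hI⟩ : ∃ I : Finset (properMinimalSubsystems X), I =
    Finset.univ.filter fun M => M.1.carrier.Infinite := ⟨_, rfl⟩
  have hIcard : I.card = i := by
    have h1 := hX.encard_infinite
    have h2 : {M ∈ properMinimalSubsystems X | M.carrier.Infinite} =
        ((I.map (Function.Embedding.subtype _) : Finset _) : Set (Subshift A ℤ)) := by
      ext M
      simp [hI, and_comm]
    rw [h2, Set.encard_coe_eq_coe_finsetCard, Finset.card_map] at h1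
    exact_mod_cast h1
  obtain ⟨N, hN⟩ := exists_disjoint_words_properMinimalSubsystems (X := X)
  have hcol := isColored_blockColor hrec hx (Set.nonempty_coe_sort.1 inferInstance) hN
  have hle := fun (n : ℕ) (hn : 1 ≤ n) => ncard_badWords_add_le hx hN I
    (fun M hM => by simpa [hI] using hM) hn
  rw [hIcard] at hle
  constructor
  · refine limsup_eq_top_of_frequently fun C => ?_
    rw [frequently_atTop]
    intro m
    obtain ⟨n, hn, hb⟩ := hcol.frequently_le_ncard_badWords (⌈C⌉ + (j + 1) * N) (m + 1)
    refine ⟨n + N, by omega, ?_⟩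
    have h1 := hle n (by omega)
    rw [hcard] at hb
    have h2 : ((⌈C⌉ : ℝ) + (j + 1) * N + (j + 1) * n) ≤ ((badWords (fun p => win x p (N + 1))
      (blockColor X (N + 1)) n).ncard : ℝ) := by exact_mod_cast hb
    have h3 : ((badWords (fun p => win x p (N + 1)) (blockColor X (N + 1)) n).ncard : ℝ) +
      i * (n + N + 1) ≤ complexity X (n + N) := by exact_mod_cast h1
    have h4 := Int.le_ceil C
    push_cast
    have : (0 : ℝ) ≤ i := by positivity
    linarith
  · refine liminf_eq_top_of_eventually fun C => ?_
    obtain ⟨n₁, hn₁⟩ := hcol.eventually_le_ncard_badWords (⌈C⌉ + j * N)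
    filter_upwards [eventually_ge_atTop (n₁ + N + 1)] with m hm
    obtain ⟨n, rfl⟩ : ∃ n, m = n + N := ⟨m - N, by omega⟩
    have h1 := hle n (by omega)
    have hb := hn₁ n (by omega)
    rw [hcard] at hb
    have h2 : ((⌈C⌉ : ℝ) + j * N + j * n) ≤ ((badWords (fun p => win x p (N + 1))
      (blockColor X (N + 1)) n).ncard : ℝ) := by exact_mod_cast hb
    have h3 : ((badWords (fun p => win x p (N + 1)) (blockColor X (N + 1)) n).ncard : ℝ) +
      i * (n + N + 1) ≤ complexity X (n + N) := by exact_mod_cast h1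
    have h4 := Int.le_ceil C
    push_cast
    have : (0 : ℝ) ≤ i := by positivity
    linarith

end Topology

/-! ### Towers of runs and their words. -/

/-- The one-sided sequence `W` is built from runs of the two-sided sequences `s 0, …, s (j - 1)`:
its prefix of length `t (K + 1)` is the prefix of length `t K`, followed by a run of `s (K % j)` of
length `ℓ K` and, whenever `j ∣ K + 1`, by another copy of the prefix of length `ω K`. -/
structure IsTower (j : ℕ) (s : ℕ → ℤ → A) (ℓ t ω : ℕ → ℕ) (W : ℕ → A) : Prop where
  two_le : 2 ≤ j
  t_zero : t 0 = 0
  ω_zero : ω 0 = 0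
  t_succ : ∀ K, ¬ j ∣ K + 1 → t (K + 1) = t K + ℓ K
  ω_succ : ∀ K, ¬ j ∣ K + 1 → ω (K + 1) = ω K
  t_wrap : ∀ K, j ∣ K + 1 → t (K + 1) = t K + ℓ K + ω K
  ω_wrap : ∀ K, j ∣ K + 1 → ω (K + 1) = t (K + 1)
  le_ℓ : ∀ K, t K + 2 * K + 1 ≤ ℓ K
  run : ∀ K p, p < ℓ K → W (t K + p) = s (K % j) (p + 1)
  copy : ∀ K p, j ∣ K + 1 → p < ω K → W (t K + ℓ K + p) = W p
  -- The first `ℓ K` letters of the right half of `s l`, starting at index `1`, equal the last `ℓ K`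
  -- letters of the left half, ending at index `-2`. The indices `-1` and `0` are left out because
  -- the Sturmian symmetry may fail there.
  symm : ∀ K, ∀ l < j, ∀ p : ℤ, 0 ≤ p → p < ℓ K → s l (p + 1) = s l (p - ℓ K - 1)

/-- The concatenation of the left half of `s a`, the prefix of `W` of length `m`, and the right
half of `s b`. -/
def glue (s : ℕ → ℤ → A) (W : ℕ → A) (a m b : ℕ) : ℤ → A := fun p =>
  if p < 0 then s a (p - 1) else if p < m then W p.toNat else s b (p - m + 1)

/-- The concatenation of the left half of `s a` and `W`. -/
def glueInf (s : ℕ → ℤ → A) (W : ℕ → A) (a : ℕ) : ℤ → A := fun p =>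
  if p < 0 then s a (p - 1) else W p.toNat

theorem glue_eq_glueInf {s : ℕ → ℤ → A} {W : ℕ → A} {t : ℕ → ℕ} (K a b : ℕ) {p : ℤ} (hp : p < t K) :
    glue s W a (t K) b p = glueInf s W a p := by
  unfold glue glueInf
  by_cases h0 : p < 0
  · rw [if_pos h0, if_pos h0]
  · rw [if_neg h0, if_neg h0, if_pos hp]

theorem exists_tower_lengths (j : ℕ) (f : ℕ → ℕ → ℕ) : ∃ ℓ t ω : ℕ → ℕ, t 0 = 0 ∧ ω 0 = 0 ∧
    (∀ K, ¬ j ∣ K + 1 → t (K + 1) = t K + ℓ K ∧ ω (K + 1) = ω K) ∧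
    (∀ K, j ∣ K + 1 → t (K + 1) = t K + ℓ K + ω K ∧ ω (K + 1) = t (K + 1)) ∧
    ∀ K, ℓ K = f K (t K) := by
  classical
  let F : ℕ → ℕ × ℕ := fun K => Nat.rec (0, 0) (fun K z =>
    if j ∣ K + 1 then (z.1 + f K z.1 + z.2, z.1 + f K z.1 + z.2) else (z.1 + f K z.1, z.2)) K
  have hF : ∀ K, F (K + 1) = if j ∣ K + 1 then ((F K).1 + f K (F K).1 + (F K).2,
      (F K).1 + f K (F K).1 + (F K).2) else ((F K).1 + f K (F K).1, (F K).2) := fun K => rfl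
  refine ⟨fun K => f K (F K).1, fun K => (F K).1, fun K => (F K).2, rfl, rfl, ?_, ?_, fun _ => rfl⟩
  · intro K hK
    simp only [hF, if_neg hK, and_self]
  · intro K hK
    simp only [hF, if_pos hK, and_self]

/-- A tower exists for all admissible run lengths. -/
theorem exists_isTower {j : ℕ} (hj : 2 ≤ j) (s : ℕ → ℤ → A) (f : ℕ → ℕ → ℕ)
    (hf : ∀ K t, t + 2 * K + 1 ≤ f K t)
    (hsymm : ∀ K t, ∀ l < j, ∀ p : ℤ, 0 ≤ p → p < f K t → s l (p + 1) = s l (p - f K t - 1)) :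
    ∃ ℓ t ω W, IsTower j s ℓ t ω W ∧ ∀ K, ℓ K = f K (t K) := by
  classical
  obtain ⟨ℓ, t, ω, h1, h2, h3, h4, h5⟩ := exists_tower_lengths j f
  let V : ℕ → ℕ → A := fun K => Nat.rec (fun _ => s 0 0) (fun K v p =>
    if p < t K then v p else if p < t K + ℓ K then s (K % j) ((p - t K : ℕ) + 1)
    else v (p - t K - ℓ K)) K
  have hV : ∀ K p, V (K + 1) p = if p < t K then V K p else
      if p < t K + ℓ K then s (K % j) ((p - t K : ℕ) + 1) else V K (p - t K - ℓ K) :=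
    fun _ _ => rfl
  have hℓ : ∀ K, t K + 2 * K + 1 ≤ ℓ K := fun K => h5 K ▸ hf K (t K)
  have ht : ∀ K, t K + ℓ K ≤ t (K + 1) := by
    intro K
    by_cases hK : j ∣ K + 1
    · rw [(h4 K hK).1]; omega
    · rw [(h3 K hK).1]
  have htm : Monotone t := monotone_nat_of_le_succ fun K => by have := ht K; omega
  have hωt : ∀ K, ω K ≤ t K := by
    intro K
    induction K with
    | zero => omega
    | succ K ih =>
      by_cases hK : j ∣ K + 1
      · rw [(h4 K hK).2]
      · rw [(h3 K hK).2]; have := ht K; omega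
  have hself : ∀ K, K ≤ t K := by
    intro K
    induction K with
    | zero => omega
    | succ K ih => have := ht K; have := hℓ K; omega
  have hcoh : ∀ K K' p, K ≤ K' → p < t K → V K' p = V K p := by
    intro K K' p hK hp
    induction K', hK using Nat.le_induction with
    | base => rfl
    | succ K' hK ih =>
      rw [hV, if_pos (lt_of_lt_of_le hp (htm hK)), ih]
  have hW : ∀ K p, p < t K → V (p + 1) p = V K p := by
    intro K p hp
    have h1 : p < t (p + 1) := by have := hself (p + 1); omega
    rcases le_total (p + 1) K with h | h
    · exact (hcoh _ _ p h h1).symm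
    · exact hcoh _ _ p h hp
  refine ⟨ℓ, t, ω, fun p => V (p + 1) p, ⟨hj, h1, h2, fun K hK => (h3 K hK).1,
    fun K hK => (h3 K hK).2, fun K hK => (h4 K hK).1, fun K hK => (h4 K hK).2, hℓ, ?_, ?_, ?_⟩, h5⟩
  · intro K p hp
    have := ht K
    rw [hW (K + 1) _ (by omega), hV, if_neg (by omega), if_pos (by omega), Nat.add_sub_cancel_left]
  · intro K p hK hp
    rw [hW (K + 1) _ (by rw [(h4 K hK).1]; omega), hV, if_neg (by omega), if_neg (by omega),
      hW K p (lt_of_lt_of_le hp (hωt K))]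
    congr 1
    omega
  · intro K l hl p
    rw [h5]
    exact hsymm K (t K) l hl p

namespace IsTower

variable {j : ℕ} {s : ℕ → ℤ → A} {ℓ t ω : ℕ → ℕ} {W : ℕ → A} (H : IsTower j s ℓ t ω W)

include H

theorem t_add_ℓ_le (K : ℕ) : t K + ℓ K ≤ t (K + 1) := by
  by_cases hK : j ∣ K + 1
  · rw [H.t_wrap K hK]; omega
  · rw [H.t_succ K hK]

theorem ω_le_t (K : ℕ) : ω K ≤ t K := by
  induction K with
  | zero => rw [H.ω_zero]; omega
  | succ K ih =>
    by_cases hK : j ∣ K + 1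
    · rw [H.ω_wrap K hK]
    · rw [H.ω_succ K hK]; have := H.t_add_ℓ_le K; omega

theorem le_t (K : ℕ) : K ≤ t K := by
  induction K with
  | zero => omega
  | succ K ih => have := H.t_add_ℓ_le K; have := H.le_ℓ K; omega

theorem ℓ_strictMono : StrictMono ℓ := strictMono_nat_of_lt_succ fun K => by
  have := H.t_add_ℓ_le K; have := H.le_ℓ (K + 1); omega

theorem ω_eq_t {K : ℕ} (hK : j ∣ K) : ω K = t K := by
  rcases K with _ | K
  · rw [H.ω_zero, H.t_zero]
  · exact H.ω_wrap K hK

theorem mod_of_dvd {K : ℕ} (hK : j ∣ K + 1) : K % j = j - 1 := by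
  have hj := H.two_le
  obtain ⟨c, hc⟩ := hK
  rcases c with _ | c
  · omega
  · have : K = j - 1 + j * c := by rw [mul_add] at hc; omega
    rw [this, Nat.add_mul_mod_self_left, Nat.mod_eq_of_lt (by omega)]

theorem mod_of_not_dvd {K : ℕ} (hK : ¬ j ∣ K + 1) :
    (K + 1) % j = K % j + 1 ∧ K % j + 1 < j := by
  have hj := H.two_le
  have h1 := Nat.mod_lt K (show 0 < j by omega)
  have h2 := Nat.div_add_mod K j
  have hlt : K % j + 1 < j := by
    by_contra hge
    refine hK ⟨K / j + 1, ?_⟩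
    rw [mul_add]; omega
  refine ⟨?_, hlt⟩
  rw [Nat.add_mod, Nat.mod_eq_of_lt (show 1 < j by omega), Nat.mod_eq_of_lt hlt]

/-- A long run splits the concatenation containing it into two. -/
theorem glue_left (K a r b : ℕ) {p : ℤ} (hp : p < t K + ℓ K) :
    glue s W a (t K + ℓ K + r) b p = glue s W a (t K) (K % j) p := by
  unfold glue
  by_cases h0 : p < 0
  · rw [if_pos h0, if_pos h0]
  · rw [if_neg h0, if_neg h0, if_pos (by push_cast; omega)]
    by_cases h1 : p < t K
    · rw [if_pos h1]
    · rw [if_neg h1]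
      have := H.run K (p - t K).toNat (by omega)
      rw [show t K + (p - t K).toNat = p.toNat by omega] at this
      rw [this]
      congr 1; omega

theorem glue_right (K a r b : ℕ) (hr : r = 0 ∨ r = ω K ∧ j ∣ K + 1) {p : ℤ} (hp : t K ≤ p) :
    glue s W a (t K + ℓ K + r) b p = glue s W (K % j) r b (p - (t K + ℓ K)) := by
  have hj := H.two_le
  unfold glue
  rw [if_neg (by omega)]
  by_cases h1 : p < t K + ℓ K
  · rw [if_pos (by push_cast; omega), if_pos (by omega)]
    have := H.run K (p - t K).toNat (by omega)
    rw [show t K + (p - t K).toNat = p.toNat by omega] at this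
    rw [this, show (((p - t K).toNat : ℕ) : ℤ) = p - t K by omega,
      H.symm K (K % j) (Nat.mod_lt _ (by omega)) _ (by omega) (by omega)]
    congr 1; ring
  · rw [if_neg (show ¬ p - (t K + ℓ K) < 0 by omega)]
    by_cases h2 : p < (t K + ℓ K + r : ℕ)
    · rw [if_pos h2, if_pos (by push_cast at h2; omega)]
      rcases hr with rfl | ⟨rfl, hK⟩
      · push_cast at h2; omega
      · push_cast at h2
        have := H.copy K (p - (t K + ℓ K)).toNat hK (by omega)
        rwa [show t K + ℓ K + (p - (t K + ℓ K)).toNat = p.toNat by omega] at this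
    · rw [if_neg h2, if_neg (by push_cast at h2; omega)]
      push_cast
      congr 1; ring

/-- A window no longer than the run cannot stick out on both sides of it. By the symmetry of the
run, it is seen either as the beginning of a right half or as the end of a left half. -/
theorem win_glue_split (K a r b : ℕ) (hr : r = 0 ∨ r = ω K ∧ j ∣ K + 1) {n : ℕ} (hn : n ≤ ℓ K)
    (p : ℤ) : (∃ q, win (glue s W a (t K + ℓ K + r) b) p n = win (glue s W a (t K) (K % j)) q n) ∨
      ∃ q, win (glue s W a (t K + ℓ K + r) b) p n = win (glue s W (K % j) r b) q n := by
  by_cases h : t K ≤ p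
  · right
    refine ⟨p - (t K + ℓ K), win_eq_win.2 fun u h0 h1 => ?_⟩
    rw [H.glue_right K a r b hr (by omega)]
    congr 1; ring
  · left
    exact ⟨p, win_eq_win.2 fun u h0 h1 => H.glue_left K a r b (by omega)⟩

end IsTower

/-! ### Complexity and recurrence of the tower. -/

/-- The words of length `n` of the connections between long runs at stage `K`. -/
def Allowed (j : ℕ) (s : ℕ → ℤ → A) (t ω : ℕ → ℕ) (W : ℕ → A) (K n : ℕ) (w : Fin n → A) : Prop :=
  (∃ p, w = win (glue s W (j - 1) (ω K) 0) p n) ∨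
  (∃ p, w = win (glue s W (j - 1) (t K) (K % j)) p n) ∨
  ∃ l, l + 1 < j ∧ ∃ p, w = win (glue s W l 0 (l + 1)) p n

namespace IsTower

variable {j : ℕ} {s : ℕ → ℤ → A} {ℓ t ω : ℕ → ℕ} {W : ℕ → A} (H : IsTower j s ℓ t ω W)

include H

/-- The prefix at stage `K + 1` contains the run of length `ℓ K ≥ n`; splitting there leaves only
connections of stage `K`. -/
theorem allowed_of_succ {K n : ℕ} (hn : n ≤ ℓ K) {w : Fin n → A}
    (hw : Allowed j s t ω W (K + 1) n w) : Allowed j s t ω W K n w := by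
  by_cases hK : j ∣ K + 1
  · have key : ∀ p, Allowed j s t ω W K n (win (glue s W (j - 1) (t K + ℓ K + ω K) 0) p n) := by
      intro p
      rcases H.win_glue_split K (j - 1) (ω K) 0 (Or.inr ⟨rfl, hK⟩) hn p with ⟨q, e⟩ | ⟨q, e⟩
      · exact Or.inr (Or.inl ⟨q, e⟩)
      · rw [H.mod_of_dvd hK] at e
        exact Or.inl ⟨q, e⟩
    rcases hw with ⟨p, rfl⟩ | ⟨p, rfl⟩ | h
    · rw [H.ω_wrap K hK, H.t_wrap K hK]; exact key p
    · rw [H.t_wrap K hK, Nat.mod_eq_zero_of_dvd hK]; exact key p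
    · exact Or.inr (Or.inr h)
  · obtain ⟨e1, e2⟩ := H.mod_of_not_dvd hK
    rcases hw with ⟨p, rfl⟩ | ⟨p, rfl⟩ | h
    · rw [H.ω_succ K hK]; exact Or.inl ⟨p, rfl⟩
    · rw [H.t_succ K hK, e1]
      rcases H.win_glue_split K (j - 1) 0 (K % j + 1) (Or.inl rfl) hn p with ⟨q, e⟩ | ⟨q, e⟩
      · exact Or.inr (Or.inl ⟨q, e⟩)
      · exact Or.inr (Or.inr ⟨K % j, e2, q, e⟩)
    · exact Or.inr (Or.inr h)

theorem allowed_win {K n : ℕ} (hn : n ≤ ℓ K) (p : ℤ) :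
    Allowed j s t ω W K n (win (glueInf s W (j - 1)) p n) := by
  have key : ∀ d w, Allowed j s t ω W (K + d) n w → Allowed j s t ω W K n w := by
    intro d w hw
    induction d with
    | zero => exact hw
    | succ d ih =>
      exact ih (H.allowed_of_succ (hn.trans (H.ℓ_strictMono.monotone (by omega))) hw)
  refine key (p + n).toNat _ (Or.inr (Or.inl ⟨p, win_eq_win.2 fun u h0 h1 => ?_⟩))
  have := H.le_t (K + (p + n).toNat)
  exact (glue_eq_glueInf _ _ _ (by omega)).symm

/-- `W` preceded by the left half of the last sequence recurs inside `W`. -/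
theorem glueInf_copy {K : ℕ} (hK : j ∣ K + 1) {p : ℤ} (h0 : -ℓ K ≤ p) (h1 : p < ω K) :
    glueInf s W (j - 1) (t K + ℓ K + p) = glueInf s W (j - 1) p := by
  have hj := H.two_le
  unfold glueInf
  rw [if_neg (by omega)]
  by_cases hp : p < 0
  · rw [if_pos hp]
    have := H.run K (ℓ K + p).toNat (by omega)
    rw [show t K + (ℓ K + p).toNat = (t K + ℓ K + p).toNat by omega, H.mod_of_dvd hK] at this
    rw [this, H.symm K (j - 1) (by omega) _ (by omega) (by omega)]
    congr 1; omega
  · rw [if_neg hp]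
    have := H.copy K p.toNat hK (by omega)
    rwa [show t K + ℓ K + p.toNat = (t K + ℓ K + p).toNat by omega] at this

theorem isRecurrent_glueInf : IsRecurrent (glueInf s W (j - 1)) := by
  have hj := H.two_le
  intro i n
  obtain ⟨m, hm⟩ : ∃ m : ℕ, i.natAbs + n ≤ m := ⟨_, le_rfl⟩
  obtain ⟨K, hK⟩ : ∃ K, K + 1 = j * (m + 1) := ⟨j * (m + 1) - 1, by
    have : 0 < j * (m + 1) := by positivity
    omega⟩
  -- `K` is the last stage of a cycle, so `ω K` is still the prefix length `t (j * m)` from the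
  -- start of that cycle.
  have hω : m ≤ ω K := by
    have hmono : ∀ d, d < j → ω (j * m + d) = ω (j * m) := by
      intro d hd
      induction d with
      | zero => rfl
      | succ d ih =>
        rw [← add_assoc, H.ω_succ _ _, ih (by omega)]
        rintro ⟨c, hc⟩
        have h1 : j * m < j * c := by omega
        have h2 : j * c < j * (m + 1) := by rw [mul_add]; omega
        have h3 := lt_of_mul_lt_mul_left h1 (Nat.zero_le _)
        have h4 := lt_of_mul_lt_mul_left h2 (Nat.zero_le _)
        omega
    have e : K = j * m + (j - 1) := by rw [mul_add] at hK; omega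
    rw [e, hmono _ (by omega), H.ω_eq_t (Dvd.intro _ rfl)]
    refine le_trans ?_ (H.le_t _)
    exact Nat.le_mul_of_pos_left _ (by omega)
  have h1 := H.le_ℓ K
  have h2 := H.ω_le_t K
  refine ⟨t K + ℓ K + i, by omega, fun k => ?_⟩
  have hk := k.2
  rw [add_assoc]
  exact H.glueInf_copy ⟨_, hK⟩ (by omega) (by omega)

theorem win_run (K n : ℕ) {q : ℤ} (h0 : 1 ≤ q) (h1 : q + n ≤ ℓ K + 1) :
    win (glueInf s W (j - 1)) (t K + q - 1) n = win (s (K % j)) q n := by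
  rw [win_eq_win]
  intro u hu0 hu1
  unfold glueInf
  rw [if_neg (by omega)]
  have := H.run K (q + u - 1).toNat (by omega)
  rw [show t K + (q + u - 1).toNat = (t K + q - 1 + u).toNat by omega] at this
  rw [this]
  congr 1; omega

end IsTower

theorem win_glue_of_add_le {s : ℕ → ℤ → A} {W : ℕ → A} {a m b n : ℕ} {p : ℤ} (hp : p + n ≤ 0) :
    win (glue s W a m b) p n = win (s a) (p - 1) n := by
  rw [win_eq_win]
  intro u h0 h1
  unfold glue
  rw [if_pos (by omega)]
  congr 1; ring

theorem win_glue_of_le {s : ℕ → ℤ → A} {W : ℕ → A} {a m b n : ℕ} {p : ℤ} (hp : m ≤ p) :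
    win (glue s W a m b) p n = win (s b) (p - m + 1) n := by
  rw [win_eq_win]
  intro u h0 h1
  unfold glue
  rw [if_neg (by omega), if_neg (by omega)]
  congr 1; ring

/-- The words of length `n` of the sequences `s 0, …, s (j - 1)`. -/
def pureWords (j : ℕ) (s : ℕ → ℤ → A) (n : ℕ) : Set (Fin n → A) :=
  {w | ∃ l < j, ∃ q, w = win (s l) q n}

/-- The words of length `n` of a concatenation starting in the interval `(-n, c)`. -/
def connWords (s : ℕ → ℤ → A) (W : ℕ → A) (n a m b c : ℕ) : Set (Fin n → A) :=
  (fun p => win (glue s W a m b) p n) '' (Finset.Ioo (-n : ℤ) c)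

theorem ncard_connWords_le (s : ℕ → ℤ → A) (W : ℕ → A) (n a m b c : ℕ) :
    (connWords s W n a m b c).ncard ≤ n + c := by
  refine (Set.ncard_image_le (Finset.finite_toSet _)).trans ?_
  rw [Set.ncard_coe_finset, Int.card_Ioo]
  omega

theorem win_glue_mem {j : ℕ} {s : ℕ → ℤ → A} {W : ℕ → A} {a b : ℕ} (ha : a < j) (hb : b < j)
    (m n : ℕ) (p : ℤ) :
    win (glue s W a m b) p n ∈ pureWords j s n ∪ connWords s W n a m b m := by
  rcases le_or_gt (p + n) 0 with h | h
  · exact Or.inl ⟨a, ha, _, win_glue_of_add_le h⟩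
  rcases le_or_gt (m : ℤ) p with h' | h'
  · exact Or.inl ⟨b, hb, _, win_glue_of_le h'⟩
  · exact Or.inr ⟨p, by simp only [Finset.coe_Ioo, Set.mem_Ioo]; omega, rfl⟩

theorem ncard_iUnion_connWords_le (j : ℕ) (s : ℕ → ℤ → A) (W : ℕ → A) (n : ℕ) :
    (⋃ l ∈ Finset.range (j - 1), connWords s W n l 0 (l + 1) 0).ncard ≤ (j - 1) * n := by
  refine (Finset.set_ncard_biUnion_le _ _).trans ?_
  refine (Finset.sum_le_card_nsmul _ _ n fun l _ => ncard_connWords_le s W n l 0 (l + 1) 0).trans ?_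
  simp

namespace IsTower

variable {j : ℕ} {s : ℕ → ℤ → A} {ℓ t ω : ℕ → ℕ} {W : ℕ → A} (H : IsTower j s ℓ t ω W)
  [TopologicalSpace A] [DiscreteTopology A] [Finite A]

include H

/-- At the start of a cycle `ω K = t K` and `K % j = 0`, so the two long connections coincide. One
long and `j - 1` short connections remain. -/
theorem complexity_le_of_dvd {K n : ℕ} (hK : j ∣ K) (hn : n ≤ ℓ K) :
    complexity (orbitSubshift (glueInf s W (j - 1))) n ≤
      (pureWords j s n).ncard + j * n + t K := by
  have hj := H.two_le
  have hsub : words (orbitSubshift (glueInf s W (j - 1))) n ⊆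
      (pureWords j s n ∪ connWords s W n (j - 1) (t K) 0 (t K)) ∪
        ⋃ l ∈ Finset.range (j - 1), connWords s W n l 0 (l + 1) 0 := by
    intro w hw
    obtain ⟨p, rfl⟩ := (mem_words_orbit rfl).1 hw
    rcases H.allowed_win hn p with ⟨q, e⟩ | ⟨q, e⟩ | ⟨l, hl, q, e⟩
    · rw [e, H.ω_eq_t hK]
      exact Or.inl (win_glue_mem (by omega) (by omega) _ _ _)
    · rw [e, Nat.mod_eq_zero_of_dvd hK]
      exact Or.inl (win_glue_mem (by omega) (by omega) _ _ _)
    · rw [e]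
      rcases win_glue_mem (s := s) (W := W) (show l < j by omega) hl 0 n q with h | h
      · exact Or.inl (Or.inl h)
      · exact Or.inr (Set.mem_biUnion (by simp; omega) h)
  have h1 := Set.ncard_le_ncard hsub (Set.toFinite _)
  have h2 := Set.ncard_union_le (pureWords j s n ∪ connWords s W n (j - 1) (t K) 0 (t K))
    (⋃ l ∈ Finset.range (j - 1), connWords s W n l 0 (l + 1) 0)
  have h3 := Set.ncard_union_le (pureWords j s n) (connWords s W n (j - 1) (t K) 0 (t K))
  have h4 := ncard_iUnion_connWords_le j s W n
  have h5 := ncard_connWords_le s W n (j - 1) (t K) 0 (t K)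
  have h6 : j * n = (j - 1) * n + n := by
    rw [← Nat.succ_mul]; congr 1; omega
  unfold complexity
  omega

/-- Inside a cycle there are two long connections at stage `K + 1`. Windows of the second that start
at or after `t K` see only a short junction, so it contributes at most `n + t K` new words. At the
end of a cycle the copied prefix gives `t (K + 1) ≤ n + 2 * t K`. -/
theorem complexity_le_of_le {K n : ℕ} (hK : ℓ K ≤ n) (hn : n ≤ ℓ (K + 1)) :
    complexity (orbitSubshift (glueInf s W (j - 1))) n ≤
      (pureWords j s n).ncard + (j + 1) * n + 2 * t K := by
  have hj := H.two_le
  have hω := H.ω_le_t K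
  have hjn : (j + 1) * n = j * n + n := by ring
  by_cases hd : j ∣ K + 1
  · have := H.complexity_le_of_dvd hd hn
    rw [H.t_wrap K hd] at this
    omega
  obtain ⟨e1, e2⟩ := H.mod_of_not_dvd hd
  have hsub : words (orbitSubshift (glueInf s W (j - 1))) n ⊆
      ((pureWords j s n ∪ connWords s W n (j - 1) (ω K) 0 (ω K)) ∪
        connWords s W n (j - 1) (t K + ℓ K) (K % j + 1) (t K)) ∪
        ⋃ l ∈ Finset.range (j - 1), connWords s W n l 0 (l + 1) 0 := by
    intro w hw
    obtain ⟨p, rfl⟩ := (mem_words_orbit rfl).1 hw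
    have short : ∀ l, l + 1 < j → ∀ q, win (glue s W l 0 (l + 1)) q n ∈
        ((pureWords j s n ∪ connWords s W n (j - 1) (ω K) 0 (ω K)) ∪
        connWords s W n (j - 1) (t K + ℓ K) (K % j + 1) (t K)) ∪
        ⋃ l ∈ Finset.range (j - 1), connWords s W n l 0 (l + 1) 0 := by
      intro l hl q
      rcases win_glue_mem (s := s) (W := W) (show l < j by omega) hl 0 n q with h | h
      · exact Or.inl (Or.inl (Or.inl h))
      · exact Or.inr (Set.mem_biUnion (by simp; omega) h)
    rcases H.allowed_win hn p with ⟨q, e⟩ | ⟨q, e⟩ | ⟨l, hl, q, e⟩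
    · rw [e, H.ω_succ K hd]
      exact Or.inl (Or.inl (win_glue_mem (by omega) (by omega) _ _ _))
    · rw [e, H.t_succ K hd, e1]
      rcases le_or_gt (q + n) 0 with h | h
      · exact Or.inl (Or.inl (Or.inl ⟨j - 1, by omega, _, win_glue_of_add_le h⟩))
      rcases le_or_gt (t K : ℤ) q with h' | h'
      · rw [show win (glue s W (j - 1) (t K + ℓ K) (K % j + 1)) q n =
            win (glue s W (K % j) 0 (K % j + 1)) (q - (t K + ℓ K)) n from ?_]
        · exact short _ e2 _
        refine win_eq_win.2 fun u h0 h1 => ?_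
        rw [show q - (t K + ℓ K) + u = q + u - (t K + ℓ K) by ring]
        exact H.glue_right K (j - 1) 0 (K % j + 1) (Or.inl rfl) (by omega)
      · exact Or.inl (Or.inr ⟨q, by simp only [Finset.coe_Ioo, Set.mem_Ioo]; omega, rfl⟩)
    · rw [e]
      exact short l hl q
  have h1 := Set.ncard_le_ncard hsub (Set.toFinite _)
  have h2 := Set.ncard_union_le ((pureWords j s n ∪ connWords s W n (j - 1) (ω K) 0 (ω K)) ∪
    connWords s W n (j - 1) (t K + ℓ K) (K % j + 1) (t K))
    (⋃ l ∈ Finset.range (j - 1), connWords s W n l 0 (l + 1) 0)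
  have h3 := Set.ncard_union_le (pureWords j s n ∪ connWords s W n (j - 1) (ω K) 0 (ω K))
    (connWords s W n (j - 1) (t K + ℓ K) (K % j + 1) (t K))
  have h4 := Set.ncard_union_le (pureWords j s n) (connWords s W n (j - 1) (ω K) 0 (ω K))
  have h5 := ncard_iUnion_connWords_le j s W n
  have h6 := ncard_connWords_le s W n (j - 1) (ω K) 0 (ω K)
  have h7 := ncard_connWords_le s W n (j - 1) (t K + ℓ K) (K % j + 1) (t K)
  have h8 : j * n = (j - 1) * n + n := by
    rw [← Nat.succ_mul]; congr 1; omega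
  unfold complexity
  omega

theorem complexity_le {g : ℕ → ℕ} (hg : Monotone g) (hgt : ∀ K, 2 * t K ≤ g (ℓ K)) (n : ℕ) :
    complexity (orbitSubshift (glueInf s W (j - 1))) n ≤
      (pureWords j s n).ncard + (j + 1) * n + g n := by
  rcases le_or_gt n (ℓ 0) with h | h
  · have := H.complexity_le_of_dvd (dvd_zero j) h
    rw [H.t_zero] at this
    have hjn : (j + 1) * n = j * n + n := by ring
    omega
  · have hex : ∃ K, n ≤ ℓ K := ⟨n, H.ℓ_strictMono.le_apply⟩
    obtain ⟨K, hK⟩ : ∃ K, Nat.find hex = K + 1 := Nat.exists_eq_succ_of_ne_zero (by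
      intro h0
      have := Nat.find_spec hex
      rw [h0] at this
      omega)
    have h1 := Nat.find_spec hex
    have h2 := Nat.find_min hex (show K < Nat.find hex by omega)
    rw [hK] at h1
    have h3 := H.complexity_le_of_le (by omega) h1
    have h4 := hgt K
    have h5 := hg (show ℓ K ≤ n by omega)
    omega

theorem complexity_le_frequently {g : ℕ → ℕ} (hgt : ∀ K, 2 * t K ≤ g (ℓ K)) :
    ∃ᶠ n in atTop, complexity (orbitSubshift (glueInf s W (j - 1))) n ≤
      (pureWords j s n).ncard + j * n + g n := by
  have hj := H.two_le
  rw [frequently_atTop]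
  intro N
  refine ⟨ℓ (j * N), ?_, ?_⟩
  · exact le_trans (Nat.le_mul_of_pos_left _ (by omega)) H.ℓ_strictMono.le_apply
  · have h1 := H.complexity_le_of_dvd (Dvd.intro N rfl) le_rfl
    have h2 := hgt (j * N)
    omega

end IsTower

/-! ### Minimal subsystems of the tower. -/

/-- Every word of `x` recurs in `x` with bounded gaps. -/
def IsUniformlyRecurrent (x : ℤ → A) : Prop :=
  ∀ (q : ℤ) (n : ℕ), ∃ R : ℕ, ∀ m : ℤ, ∃ m', m ≤ m' ∧ m' ≤ m + R ∧ win x m' n = win x q n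

theorem win_sub {x y : ℤ → A} {p q : ℤ} {n m o : ℕ} (h : win x p n = win y q n) (ho : o + m ≤ n) :
    win x (p + o) m = win y (q + o) m := by
  rw [win_eq_win] at h ⊢
  intro u h0 h1
  have := h (o + u) (by omega) (by omega)
  rwa [← add_assoc, ← add_assoc] at this

section Topology

variable [TopologicalSpace A] [DiscreteTopology A]

theorem IsUniformlyRecurrent.isMinimalSubshift {x : ℤ → A} (h : IsUniformlyRecurrent x) :
    IsMinimalSubshift (orbitSubshift x) := by
  refine ⟨⟨x, self_mem_orbitClosure x⟩, fun y hy => ?_⟩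
  refine Set.Subset.antisymm (orbitClosure_subset (X := orbitSubshift y) ?_)
    (orbitClosure_subset hy)
  refine mem_orbitClosure_iff.2 fun i n => ?_
  obtain ⟨R, hR⟩ := h i n
  obtain ⟨m, hm⟩ := mem_orbitClosure_iff.1 hy 0 (R + n)
  obtain ⟨m', h0, h1, e⟩ := hR m
  refine ⟨0 + (m' - m).toNat, ?_⟩
  rw [win_sub hm (by omega), ← e]
  congr 1; omega

namespace IsTower

variable {j : ℕ} {s : ℕ → ℤ → A} {ℓ t ω : ℕ → ℕ} {W : ℕ → A} (H : IsTower j s ℓ t ω W)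

include H

theorem orbitSubshift_subset {l : ℕ} (hl : l < j) (h : IsUniformlyRecurrent (s l)) :
    (orbitSubshift (s l)).carrier ⊆ (orbitSubshift (glueInf s W (j - 1))).carrier := by
  intro y hy
  refine mem_orbitClosure_iff.2 fun p n => ?_
  obtain ⟨q, hq⟩ := mem_orbitClosure_iff.1 hy p n
  obtain ⟨R, hR⟩ := h q n
  obtain ⟨q', h0, h1, e⟩ := hR 1
  have h2 := H.le_ℓ (l + j * (R + n + 1))
  have h3 : R + n + 1 ≤ j * (R + n + 1) := Nat.le_mul_of_pos_left _ (by omega)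
  have h4 := H.win_run (l + j * (R + n + 1)) n h0 (by omega)
  rw [Nat.add_mul_mod_self_left, Nat.mod_eq_of_lt hl, e, ← hq] at h4
  exact ⟨_, h4.symm⟩

/-- Long words of the orbit closure contain words of the sequences `s l`. -/
theorem exists_word_mem {M : Subshift A ℤ} (hM : M.carrier.Nonempty)
    (hsub : M.carrier ⊆ (orbitSubshift (glueInf s W (j - 1))).carrier) (n : ℕ) :
    ∃ l < j, (words M n ∩ words (orbitSubshift (s l)) n).Nonempty := by
  have hj := H.two_le
  have hω := H.ω_le_t n
  obtain ⟨y, hy⟩ := hM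
  obtain ⟨p, hp⟩ := mem_orbitClosure_iff.1 (hsub hy) 0 (t n + 2 * n)
  have key : ∀ a < j, ∀ b < j, ∀ m ≤ t n, (∃ q, win y 0 (t n + 2 * n) =
      win (glue s W a m b) q (t n + 2 * n)) →
      ∃ l < j, (words M n ∩ words (orbitSubshift (s l)) n).Nonempty := by
    rintro a ha b hb m hm ⟨q, e⟩
    -- The middle block has length at most `t n`, so in a window of length `t n + 2 * n` either the
    -- first or the last `n` letters lie in a pure half.
    rcases le_or_gt (q + n) 0 with h | h
    · have e' := win_sub (o := 0) (m := n) e (by omega)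
      rw [Nat.cast_zero, add_zero, win_glue_of_add_le (by omega)] at e'
      refine ⟨a, ha, win y 0 n, win_mem_words hy _ _, ?_⟩
      rw [e']
      exact win_mem_words (self_mem_orbitClosure (s a)) _ _
    · have e' := win_sub (o := t n + n) (m := n) e (by omega)
      rw [win_glue_of_le (p := q + (t n + n : ℕ)) (by push_cast; omega)] at e'
      refine ⟨b, hb, win y (0 + (t n + n : ℕ)) n, win_mem_words hy _ _, ?_⟩
      rw [e']
      exact win_mem_words (self_mem_orbitClosure (s b)) _ _
  have hn := H.le_ℓ n
  rcases H.allowed_win (K := n) (n := t n + 2 * n) (by omega) p with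
    ⟨q, e⟩ | ⟨q, e⟩ | ⟨l, hl, q, e⟩
  · exact key (j - 1) (by omega) 0 (by omega) _ hω ⟨q, hp.trans e⟩
  · exact key (j - 1) (by omega) _ (Nat.mod_lt _ (by omega)) _ le_rfl ⟨q, hp.trans e⟩
  · exact key l (by omega) _ hl _ (Nat.zero_le _) ⟨q, hp.trans e⟩

variable [Finite A]

/-- By pigeonhole, one component shares arbitrarily long words with `M`, hence a point by
compactness, and minimal subshifts that meet are equal. -/
theorem exists_eq_orbitSubshift (hrec : ∀ l < j, IsUniformlyRecurrent (s l)) {M : Subshift A ℤ}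
    (hM : IsMinimalSubshift M)
    (hsub : M.carrier ⊆ (orbitSubshift (glueInf s W (j - 1))).carrier) :
    ∃ l < j, orbitSubshift (s l) = M := by
  have hw := H.exists_word_mem hM.1 hsub
  obtain ⟨l, hl, hinf⟩ : ∃ l < j, ∃ᶠ n in atTop,
      (words M n ∩ words (orbitSubshift (s l)) n).Nonempty := by
    by_contra hcon
    push Not at hcon
    have hev : ∀ᶠ n in atTop, ∀ l ∈ Finset.range j,
        ¬ (words M n ∩ words (orbitSubshift (s l)) n).Nonempty :=
      (Filter.eventually_all_finset _).2 fun l hl => by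
        simpa [Set.not_nonempty_iff_eq_empty] using hcon l (Finset.mem_range.1 hl)
    obtain ⟨n, hn⟩ := hev.exists
    obtain ⟨l, hl, h⟩ := hw n
    exact hn l (Finset.mem_range.2 hl) h
  obtain ⟨y, h1, h2⟩ := exists_mem_inter (X := M) (Y := orbitSubshift (s l)) fun n => by
    obtain ⟨m, hm, w, hw, hw'⟩ := frequently_atTop.1 hinf n
    obtain ⟨y, hy, rfl⟩ := (mem_words_iff_exists_at 0).1 hw
    exact ⟨_, win_sub_mem_words hw (s := 0) (m := n) (by omega),
      win_sub_mem_words hw' (s := 0) (m := n) (by omega)⟩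
  exact ⟨l, hl, ((hrec l hl).isMinimalSubshift).eq_of_mem hM h2 h1⟩

theorem inClass (hrec : ∀ l < j, IsUniformlyRecurrent (s l))
    (hdisj : ∀ l < j, ∀ l' < j, l ≠ l' → ∀ p q, s l p ≠ s l' q) {i : ℕ} (hij : i ≤ j)
    (hinf : ∀ l < i, (orbitSubshift (s l)).carrier.Infinite)
    (hfin : ∀ l < j, i ≤ l → (orbitSubshift (s l)).carrier.Finite) :
    InClass j i (orbitSubshift (glueInf s W (j - 1))) := by
  have hj := H.two_le
  have hnot : ∀ l < j, ∀ l' < j, l ≠ l' → s l ∉ (orbitSubshift (s l')).carrier := by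
    intro l hl l' hl' hne hmem
    obtain ⟨q, hq⟩ := mem_orbitClosure_iff.1 hmem 0 1
    exact hdisj l hl l' hl' hne _ _ (win_eq_win.1 hq 0 le_rfl (by norm_num))
  have hmem : ∀ l, s l ∈ (orbitSubshift (s l)).carrier := fun l => self_mem_orbitClosure _
  have hinj : Set.InjOn (fun l => orbitSubshift (s l)) (Finset.range j : Set ℕ) := by
    intro l hl l' hl' e
    by_contra hne
    refine hnot l (by simpa using hl) l' (by simpa using hl') hne ?_
    have e' : orbitSubshift (s l) = orbitSubshift (s l') := e
    exact e' ▸ hmem l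
  have hprop : properMinimalSubsystems (orbitSubshift (glueInf s W (j - 1))) =
      (fun l => orbitSubshift (s l)) '' (Finset.range j : Set ℕ) := by
    ext M
    simp only [properMinimalSubsystems, Set.mem_ofPred_eq, Set.mem_image, Finset.coe_range,
      Set.mem_Iio]
    constructor
    · rintro ⟨h1, h2⟩
      exact H.exists_eq_orbitSubshift hrec h2 h1.subset
    · rintro ⟨l, hl, rfl⟩
      refine ⟨⟨H.orbitSubshift_subset hl (hrec l hl), fun hle => ?_⟩,
        (hrec l hl).isMinimalSubshift⟩
      obtain ⟨l', hl', hne⟩ : ∃ l' < j, l' ≠ l := by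
        rcases Nat.eq_zero_or_pos l with rfl | h
        · exact ⟨1, by omega, by omega⟩
        · exact ⟨0, by omega, by omega⟩
      exact hnot l' hl' l hl hne (hle (H.orbitSubshift_subset hl' (hrec l' hl') (hmem l')))
  refine ⟨⟨_, self_mem_orbitClosure _, H.isRecurrent_glueInf, rfl⟩, ?_, ?_⟩
  · rw [hprop, hinj.encard_image, Set.encard_coe_eq_coe_finsetCard, Finset.card_range]
  · have : {M ∈ properMinimalSubsystems (orbitSubshift (glueInf s W (j - 1))) |
        M.carrier.Infinite} = (fun l => orbitSubshift (s l)) '' (Finset.range i : Set ℕ) := by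
      ext M
      simp only [hprop, Set.mem_ofPred_eq, Set.mem_image, Finset.coe_range, Set.mem_Iio]
      constructor
      · rintro ⟨⟨l, hl, rfl⟩, h⟩
        refine ⟨l, ?_, rfl⟩
        by_contra hge
        exact h (hfin l hl (by omega))
      · rintro ⟨l, hl, rfl⟩
        exact ⟨⟨l, by omega, rfl⟩, hinf l hl⟩
    rw [this, (hinj.mono (by simpa using hij)).encard_image, Set.encard_coe_eq_coe_finsetCard,
      Finset.card_range]

end IsTower

end Topology

/-! ### Sturmian sequences. -/

/-- The first differences of `⌊n * α⌋`. -/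
def floorDiff (α : ℝ) (n : ℤ) : ℤ := ⌊((n + 1 : ℤ) : ℝ) * α⌋ - ⌊(n : ℝ) * α⌋

/-- The Sturmian sequence of slope `α`. -/
def sturmian (α : ℝ) (n : ℤ) : Bool := decide (floorDiff α n = ⌊α⌋)

theorem floor_add_mul_bounds (α : ℝ) (p k : ℤ) :
    ⌊(p : ℝ) * α⌋ + ⌊(k : ℝ) * α⌋ ≤ ⌊((p + k : ℤ) : ℝ) * α⌋ ∧
      ⌊((p + k : ℤ) : ℝ) * α⌋ ≤ ⌊(p : ℝ) * α⌋ + ⌊(k : ℝ) * α⌋ + 1 := by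
  have h1 := Int.le_floor_add ((p : ℝ) * α) ((k : ℝ) * α)
  have h2 := Int.le_floor_add_floor ((p : ℝ) * α) ((k : ℝ) * α)
  rw [← add_mul, ← Int.cast_add] at h1 h2
  omega

theorem sturmian_eq_iff {α : ℝ} {n m : ℤ} :
    sturmian α n = sturmian α m ↔ floorDiff α n = floorDiff α m := by
  refine ⟨fun h => ?_, fun h => by simp only [sturmian, h]⟩
  have hn := floor_add_mul_bounds α n 1
  have hm := floor_add_mul_bounds α m 1
  rw [Int.cast_one, one_mul] at hn hm
  simp only [sturmian, decide_eq_decide] at h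
  unfold floorDiff at h ⊢
  omega

theorem win_sturmian_eq_of_floor {α : ℝ} {p q : ℤ} {n : ℕ}
    (h : ∀ k : ℕ, k ≤ n → ⌊((p + k : ℤ) : ℝ) * α⌋ - ⌊(p : ℝ) * α⌋ =
      ⌊((q + k : ℤ) : ℝ) * α⌋ - ⌊(q : ℝ) * α⌋) :
    win (sturmian α) p n = win (sturmian α) q n := by
  funext k
  simp only [win]
  rw [sturmian_eq_iff]
  have h1 := h k k.2.le
  have h2 := h (k + 1) k.2
  push_cast [floorDiff] at h1 h2 ⊢
  simp only [← add_assoc] at h2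
  omega

/-- A word is determined by the vector of the `⌊(p + k) α⌋ - ⌊p α⌋`. These vectors are
coordinatewise monotone in the fractional part of `p α`, so their sum `ψ` determines them. Each
coordinate takes at most two consecutive values, so `ψ` takes at most `n + 1`. -/
theorem ncard_range_win_sturmian_le (α : ℝ) (n : ℕ) :
    (Set.range fun p => win (sturmian α) p n).ncard ≤ n + 1 := by
  let G : ℤ → ℕ → ℤ := fun p k => ⌊((p + (k + 1 : ℕ) : ℤ) : ℝ) * α⌋ - ⌊(p : ℝ) * α⌋
  let ψ : ℤ → ℤ := fun p => ∑ k ∈ Finset.range n, G p k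
  let B : ℤ := ∑ k ∈ Finset.range n, ⌊(((k + 1 : ℕ) : ℤ) : ℝ) * α⌋
  have hG : ∀ p k, G p k = ⌊Int.fract ((p : ℝ) * α) + (((k + 1 : ℕ) : ℤ) : ℝ) * α⌋ := by
    intro p k
    simp only [G]
    rw [← Int.floor_sub_intCast]
    congr 1
    rw [Int.fract]
    push_cast
    ring
  have hψ : ∀ p, ψ p ∈ Finset.Icc B (B + n) := by
    intro p
    rw [Finset.mem_Icc]
    constructor
    · refine Finset.sum_le_sum fun k _ => ?_
      have := (floor_add_mul_bounds α p (k + 1 : ℕ)).1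
      simp only [G]
      omega
    · have : B + n = ∑ k ∈ Finset.range n, (⌊(((k + 1 : ℕ) : ℤ) : ℝ) * α⌋ + 1) := by
        rw [Finset.sum_add_distrib]; simp [B]
      rw [this]
      refine Finset.sum_le_sum fun k _ => ?_
      have := (floor_add_mul_bounds α p (k + 1 : ℕ)).2
      simp only [G]
      omega
  have key : ∀ p q : ℤ, Int.fract ((p : ℝ) * α) ≤ Int.fract ((q : ℝ) * α) → ψ p = ψ q →
      win (sturmian α) p n = win (sturmian α) q n := by
    intro p q hle e
    have hGle : ∀ k ∈ Finset.range n, G p k ≤ G q k := by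
      intro k _
      rw [hG, hG]
      exact Int.floor_le_floor (by linarith)
    have hGeq := (Finset.sum_eq_sum_iff_of_le hGle).1 e
    refine win_sturmian_eq_of_floor fun k hk => ?_
    rcases k with _ | k
    · simp
    · exact hGeq k (Finset.mem_range.2 hk)
  have hfac : Function.FactorsThrough (fun p => win (sturmian α) p n) ψ := by
    intro p q e
    rcases le_total (Int.fract ((p : ℝ) * α)) (Int.fract ((q : ℝ) * α)) with h | h
    · exact key p q h e
    · exact (key q p h e.symm).symm
  obtain ⟨e, he⟩ := (Function.factorsThrough_iff _).1 hfac
  rw [he]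
  have hsub : Set.range (e ∘ ψ) ⊆ e '' (Finset.Icc B (B + n)) := by
    rintro _ ⟨p, rfl⟩
    exact ⟨ψ p, hψ p, rfl⟩
  refine (Set.ncard_le_ncard hsub (Set.toFinite _)).trans
    ((Set.ncard_image_le (Finset.finite_toSet _)).trans ?_)
  rw [Set.ncard_coe_finset, Int.card_Icc]
  omega

/-- If the fractional part of `m α` is smaller than all `1 - Int.fract ((q + k) α)` with `k ≤ n`,
adding `m α` causes no carry. -/
theorem exists_win_sturmian_add_eq (α : ℝ) (q : ℤ) (n : ℕ) : ∃ η > 0, ∀ m : ℤ,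
    Int.fract ((m : ℝ) * α) < η → win (sturmian α) (q + m) n = win (sturmian α) q n := by
  obtain ⟨η, hη, h⟩ : ∃ η : ℝ, 0 < η ∧ ∀ k : ℕ, k ≤ n →
      η ≤ 1 - Int.fract (((q + k : ℤ) : ℝ) * α) := by
    induction n with
    | zero => exact ⟨_, sub_pos.2 (Int.fract_lt_one _), fun k hk => by
        obtain rfl : k = 0 := by omega
        exact le_rfl⟩
    | succ n ih =>
      obtain ⟨η, hη, h⟩ := ih
      refine ⟨min η (1 - Int.fract (((q + (n + 1 : ℕ) : ℤ) : ℝ) * α)),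
        lt_min hη (sub_pos.2 (Int.fract_lt_one _)), fun k hk => ?_⟩
      rcases Nat.lt_or_ge n k with hlt | hge
      · obtain rfl : k = n + 1 := by omega
        exact min_le_right _ _
      · exact (min_le_left _ _).trans (h k hge)
  refine ⟨η, hη, fun m hm => ?_⟩
  have key : ∀ k : ℕ, k ≤ n →
      ⌊((q + m + k : ℤ) : ℝ) * α⌋ = ⌊((q + k : ℤ) : ℝ) * α⌋ + ⌊(m : ℝ) * α⌋ := by
    intro k hk
    have h1 := h k hk
    have h2 := Int.fract_nonneg ((m : ℝ) * α)
    have h3 := Int.fract_nonneg (((q + k : ℤ) : ℝ) * α)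
    have e1 := Int.floor_add_fract ((m : ℝ) * α)
    have e2 := Int.floor_add_fract (((q + k : ℤ) : ℝ) * α)
    have e3 : ((q + m + k : ℤ) : ℝ) * α = ((q + k : ℤ) : ℝ) * α + (m : ℝ) * α := by
      push_cast; ring
    rw [Int.floor_eq_iff, e3]
    push_cast at *
    constructor <;> linarith
  refine win_sturmian_eq_of_floor fun k hk => ?_
  have h0 := key 0 (Nat.zero_le _)
  rw [Nat.cast_zero, add_zero, add_zero] at h0
  rw [key k hk, h0]
  omega

section Irrational

variable {α : ℝ} (hα : Irrational α)

include hα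

theorem exists_fract_mul_lt {η : ℝ} (hη : 0 < η) :
    ∃ h : ℤ, 0 < Int.fract ((h : ℝ) * α) ∧ Int.fract ((h : ℝ) * α) < η := by
  have hd : Dense (AddSubgroup.closure {α, 1} : Set ℝ) :=
    dense_addSubgroupClosure_pair_iff.2 (by simpa using hα)
  obtain ⟨z, hz, h0, h1⟩ := hd.exists_between (show (0 : ℝ) < min η 1 by positivity)
  obtain ⟨m, n, rfl⟩ := AddSubgroup.mem_closure_pair.1 hz
  have e : Int.fract ((m : ℝ) * α) = m • α + n • (1 : ℝ) := by
    rw [← Int.fract_add_intCast _ n, Int.fract_eq_self.2]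
    · simp
    · have := h1.trans_le (min_le_right _ _)
      simp only [zsmul_eq_mul, mul_one] at h0 this
      exact ⟨h0.le, this⟩
  exact ⟨m, e ▸ h0, e ▸ h1.trans_le (min_le_left _ _)⟩

/-- Moving by `h` rotates the circle by `δ < η`, so within about `1 / δ` steps the orbit passes `0`
and lands in `[0, δ)`. -/
theorem exists_fract_mul_lt_bounded {η : ℝ} (hη : 0 < η) :
    ∃ R : ℕ, ∀ m : ℤ, ∃ m', m ≤ m' ∧ m' ≤ m + R ∧ Int.fract ((m' : ℝ) * α) < η := by
  obtain ⟨h, h0, h1⟩ := exists_fract_mul_lt hα hη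
  obtain ⟨δ, hδ⟩ : ∃ δ, δ = Int.fract ((h : ℝ) * α) := ⟨_, rfl⟩
  rw [← hδ] at h0 h1
  obtain ⟨T, hT⟩ : ∃ T : ℕ, T = ⌈1 / δ⌉₊ := ⟨_, rfl⟩
  refine ⟨2 * (T * h.natAbs), fun m => ?_⟩
  -- Since `h` may be negative, the start is moved far enough right for all steps to stay above `m`.
  obtain ⟨m₀, hm₀⟩ : ∃ m₀, m₀ = m + T * h.natAbs := ⟨_, rfl⟩
  obtain ⟨y, hy⟩ : ∃ y, y = (1 - Int.fract ((m₀ : ℝ) * α)) / δ := ⟨_, rfl⟩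
  have hf0 := Int.fract_nonneg ((m₀ : ℝ) * α)
  have hf1 := Int.fract_lt_one ((m₀ : ℝ) * α)
  have hy0 : 0 ≤ y := hy ▸ div_nonneg (by linarith) h0.le
  have hkT : ⌈y⌉₊ ≤ T := by
    rw [hT, hy]
    exact Nat.ceil_le_ceil (by gcongr; linarith)
  have hk1 := Nat.le_ceil y
  have hk2 := Nat.ceil_lt_add_one hy0
  have hyδ : y * δ = 1 - Int.fract ((m₀ : ℝ) * α) := by
    rw [hy]; field_simp
  have hb : |(⌈y⌉₊ : ℤ) * h| ≤ T * h.natAbs := by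
    rw [abs_mul, Int.natCast_natAbs, Nat.abs_cast]
    gcongr
  obtain ⟨hb1, hb2⟩ := abs_le.1 hb
  refine ⟨m₀ + ⌈y⌉₊ * h, by omega, by push_cast at *; omega, ?_⟩
  have e1 := Int.floor_add_fract ((m₀ : ℝ) * α)
  have e2 := Int.floor_add_fract ((h : ℝ) * α)
  have e3 : ((m₀ + ⌈y⌉₊ * h : ℤ) : ℝ) * α = (Int.fract ((m₀ : ℝ) * α) - 1 + ⌈y⌉₊ * δ) +
      ((⌊(m₀ : ℝ) * α⌋ + 1 + ⌈y⌉₊ * ⌊(h : ℝ) * α⌋ : ℤ) : ℝ) := by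
    push_cast
    rw [hδ]
    linear_combination (-1 : ℝ) * e1 - (⌈y⌉₊ : ℝ) * e2
  have l1 : y * δ ≤ ⌈y⌉₊ * δ := by gcongr
  have l2 : (⌈y⌉₊ : ℝ) * δ < (y + 1) * δ := by gcongr
  rw [e3, Int.fract_add_intCast]
  have hδ1 : δ < 1 := hδ ▸ Int.fract_lt_one _
  rw [Int.fract_eq_self.2 ⟨by linarith, by linarith⟩]
  linarith

theorem isUniformlyRecurrent_sturmian : IsUniformlyRecurrent (sturmian α) := by
  intro q n
  obtain ⟨η, hη, h⟩ := exists_win_sturmian_add_eq α q n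
  obtain ⟨R, hR⟩ := exists_fract_mul_lt_bounded hα hη
  refine ⟨R, fun m => ?_⟩
  obtain ⟨m', h0, h1, h2⟩ := hR (m - q)
  exact ⟨q + m', by omega, by omega, h m' h2⟩

theorem exists_sturmian_add_ne {p : ℤ} (hp : p ≠ 0) : ∃ q, sturmian α (q + p) ≠ sturmian α q := by
  by_contra hcon
  push Not at hcon
  have hstep : ∀ q : ℤ, ⌊((q + p : ℤ) : ℝ) * α⌋ - ⌊(q : ℝ) * α⌋ = ⌊(p : ℝ) * α⌋ := by
    have h1 : ∀ q : ℤ, ⌊((q + 1 + p : ℤ) : ℝ) * α⌋ - ⌊((q + 1 : ℤ) : ℝ) * α⌋ =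
        ⌊((q + p : ℤ) : ℝ) * α⌋ - ⌊(q : ℝ) * α⌋ := by
      intro q
      have := sturmian_eq_iff.1 (hcon q)
      unfold floorDiff at this
      rw [show q + 1 + p = q + p + 1 by ring]
      omega
    intro q
    induction q using Int.induction_on with
    | zero => simp
    | succ q ih => rw [h1, ih]
    | pred q ih =>
      have := h1 (-q - 1)
      rw [sub_add_cancel] at this
      rw [← this, ih]
  -- A period `p` makes `⌊(q + p) α⌋ - ⌊q α⌋` independent of `q`. At `q = -p` this gives `⌈p α⌉ = ⌊p
  -- α⌋`, so `p α` would be an integer.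
  have h := hstep (-p)
  rw [neg_add_cancel, Int.cast_zero, zero_mul, Int.floor_zero, Int.cast_neg, neg_mul,
    Int.floor_neg] at h
  have hirr : Irrational ((p : ℝ) * α) := hα.intCast_mul hp
  refine hirr ⟨⌊(p : ℝ) * α⌋, ?_⟩
  have h1 := Int.floor_le ((p : ℝ) * α)
  have h2 := Int.le_ceil ((p : ℝ) * α)
  have h3 : ⌈(p : ℝ) * α⌉ = ⌊(p : ℝ) * α⌋ := by omega
  rw [h3] at h2
  push_cast
  exact le_antisymm h1 h2

theorem exists_forall_le_abs_sub (Q : ℕ) : ∃ η : ℝ, 0 < η ∧ ∀ r : ℕ, 0 < r → r ≤ Q → ∀ z : ℤ,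
    η ≤ |(r : ℝ) * α - z| := by
  induction Q with
  | zero => exact ⟨1, one_pos, fun r h0 h1 => by omega⟩
  | succ Q ih =>
    obtain ⟨η, hη, h⟩ := ih
    refine ⟨min η |((Q + 1 : ℕ) : ℝ) * α - round (((Q + 1 : ℕ) : ℝ) * α)|,
      lt_min hη (abs_pos.2 (sub_ne_zero.2 ?_)), fun r h0 h1 z => ?_⟩
    · exact (hα.natCast_mul (Nat.succ_ne_zero Q)).ne_int _
    · rcases Nat.lt_or_ge Q r with hlt | hge
      · obtain rfl : r = Q + 1 := by omega
        exact (min_le_right _ _).trans (round_le _ _)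
      · exact (min_le_left _ _).trans (h r h0 hge z)

/-- There are arbitrarily large denominators of best approximations. -/
theorem exists_best_approximation (Q : ℕ) : ∃ q : ℕ, Q < q ∧ ∃ e : ℤ, ∀ r : ℕ, 0 < r → r < q →
    ∀ z : ℤ, |(q : ℝ) * α - e| < |(r : ℝ) * α - z| := by
  classical
  obtain ⟨η, hη, h⟩ := exists_forall_le_abs_sub hα Q
  -- The least such `q` beats every smaller denominator, and it exceeds `Q` by the choice of `η`.
  have hex : ∃ q : ℕ, 0 < q ∧ ∃ e : ℤ, |(q : ℝ) * α - e| < η := by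
    obtain ⟨m, h0, h1⟩ := exists_fract_mul_lt hα hη
    have hm : m ≠ 0 := by rintro rfl; simp at h0
    rw [← Int.self_sub_floor] at h0 h1
    refine ⟨m.natAbs, Int.natAbs_pos.2 hm, ?_⟩
    obtain ⟨k, rfl | rfl⟩ := Int.eq_nat_or_neg m
    · refine ⟨⌊((k : ℤ) : ℝ) * α⌋, ?_⟩
      rw [Int.natAbs_natCast, ← Int.cast_natCast k, abs_of_pos h0]
      exact h1
    · refine ⟨-⌊((-k : ℤ) : ℝ) * α⌋, ?_⟩
      rw [Int.natAbs_neg, Int.natAbs_natCast, ← abs_neg, show -((k : ℝ) * α -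
        ((-⌊((-k : ℤ) : ℝ) * α⌋ : ℤ) : ℝ)) = ((-k : ℤ) : ℝ) * α - ⌊((-k : ℤ) : ℝ) * α⌋ by
          push_cast; ring, abs_of_pos h0]
      exact h1
  obtain ⟨hq0, e, he⟩ := Nat.find_spec hex
  refine ⟨Nat.find hex, ?_, e, fun r h0 h1 z => ?_⟩
  · by_contra hle
    exact absurd (h _ hq0 (by omega) e) (not_le.2 he)
  · have := Nat.find_min hex h1
    push Not at this
    exact he.trans_le (this h0 z)

/-- For a best approximation `q α ≈ e`, no integer lies between `r α` and `r α + (q α - e)` when `-q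
< r < 0`, so `⌊(r + q) α⌋ = ⌊r α⌋ + e`. A first difference needs this at `r` and `r + 1`, which
leaves `q - 2` admissible positions. -/
theorem exists_symm_length_sturmian (N : ℕ) : ∃ L ≥ N, ∀ p : ℤ, 0 ≤ p → p < L →
    sturmian α (p + 1) = sturmian α (p - L - 1) := by
  obtain ⟨q, hq, e, h⟩ := exists_best_approximation hα (N + 2)
  have key : ∀ r : ℤ, -q < r → r < 0 → ⌊((r + q : ℤ) : ℝ) * α⌋ = ⌊(r : ℝ) * α⌋ + e := by
    intro r h0 h1
    have hr : ((-r).toNat : ℝ) = -r := by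
      have : (((-r).toNat : ℤ)) = -r := by omega
      exact_mod_cast this
    have l1 := h (-r).toNat (by omega) (by omega) (-⌊(r : ℝ) * α⌋)
    have l2 := h (-r).toNat (by omega) (by omega) (-(⌊(r : ℝ) * α⌋ + 1))
    have f1 := Int.floor_le ((r : ℝ) * α)
    have f2 := Int.lt_floor_add_one ((r : ℝ) * α)
    rw [hr] at l1 l2
    push_cast at l1 l2
    rw [abs_of_nonpos (a := -(r : ℝ) * α - _) (by linarith)] at l1
    rw [abs_of_nonneg (a := -(r : ℝ) * α - _) (by linarith)] at l2
    rw [Int.floor_eq_iff]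
    obtain ⟨a1, a2⟩ := abs_lt.1 l1
    obtain ⟨a3, a4⟩ := abs_lt.1 l2
    push_cast
    constructor <;> linarith
  refine ⟨q - 2, by omega, fun p h0 h1 => ?_⟩
  rw [sturmian_eq_iff, show p - (q - 2 : ℕ) - 1 = p + 1 - q by omega]
  have k1 := key (p + 1 - q) (by omega) (by omega)
  have k2 := key (p + 1 - q + 1) (by omega) (by omega)
  rw [show p + 1 - q + q = p + 1 by ring] at k1
  rw [show p + 1 - q + 1 + q = p + 1 + 1 by ring] at k2
  unfold floorDiff
  omega

end Irrational

theorem IsUniformlyRecurrent.comp {B : Type*} {x : ℤ → B} (h : IsUniformlyRecurrent x)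
    (c : B → A) : IsUniformlyRecurrent (c ∘ x) := by
  intro q n
  obtain ⟨R, hR⟩ := h q n
  refine ⟨R, fun m => ?_⟩
  obtain ⟨m', h0, h1, e⟩ := hR m
  exact ⟨m', h0, h1, congrArg (fun w => c ∘ w) e⟩

theorem isUniformlyRecurrent_const (a : A) : IsUniformlyRecurrent fun _ => a :=
  fun _ _ => ⟨0, fun m => ⟨m, le_rfl, by simp, rfl⟩⟩

theorem ncard_range_win_comp_le {B : Type*} [Finite B] (x : ℤ → B) (c : B → A) (n : ℕ) :
    (Set.range fun p => win (c ∘ x) p n).ncard ≤ (Set.range fun p => win x p n).ncard := by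
  have : (Set.range fun p => win (c ∘ x) p n) =
      (fun w => c ∘ w) '' Set.range fun p => win x p n := by
    rw [← Set.range_comp]; rfl
  rw [this]
  exact Set.ncard_image_le (Set.toFinite _)

section Topology

variable [TopologicalSpace A] [DiscreteTopology A]

theorem infinite_orbitSubshift {x : ℤ → A} (h : ∀ p ≠ 0, ∃ q, x (q + p) ≠ x q) :
    (orbitSubshift x).carrier.Infinite := by
  refine Set.infinite_of_injective_forall_mem (f := fun n : ℤ => shift n x) ?_
    fun n => subset_closure ⟨n, rfl⟩
  intro n m e
  by_contra hne
  obtain ⟨q, hq⟩ := h (n - m) (sub_ne_zero.2 hne)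
  have := congrFun e (q - m)
  simp only [shift_apply] at this
  apply hq
  convert this using 2 <;> ring

theorem finite_orbitSubshift_const (a : A) :
    (orbitSubshift fun _ : ℤ => a).carrier.Finite := by
  refine (Set.finite_singleton fun _ => a).subset fun y hy => ?_
  funext p
  obtain ⟨q, hq⟩ := mem_orbitClosure_iff.1 hy p 1
  simpa using win_eq_win.1 hq 0 le_rfl (by norm_num)

end Topology

/-! ### The extremal examples. -/

/-- The components of the examples: `i` copies of a Sturmian sequence followed by constant
sequences, over pairwise disjoint alphabets. -/
def component (i : ℕ) (c : ℕ → Bool → A) (l : ℕ) : ℤ → A :=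
  if l < i then c l ∘ sturmian √2 else fun _ => c l false

theorem ncard_pureWords_component_le [Finite A] {i j : ℕ} (c : ℕ → Bool → A) (n : ℕ) :
    (pureWords j (component i c) n).ncard ≤ i * n + j := by
  have hsub : pureWords j (component i c) n ⊆
      ⋃ l ∈ Finset.range j, Set.range fun p => win (component i c l) p n := by
    rintro _ ⟨l, hl, q, rfl⟩
    exact Set.mem_biUnion (Finset.mem_range.2 hl) ⟨q, rfl⟩
  refine (Set.ncard_le_ncard hsub (Set.toFinite _)).trans
    ((Finset.set_ncard_biUnion_le _ _).trans ?_)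
  have hle : ∀ l ∈ Finset.range j, (Set.range fun p => win (component i c l) p n).ncard ≤
      1 + if l < i then n else 0 := by
    intro l _
    unfold component
    split_ifs
    · have h1 := ncard_range_win_comp_le (sturmian √2) (c l) n
      have h2 := ncard_range_win_sturmian_le √2 n
      omega
    · refine (Set.ncard_le_ncard (t := {fun _ => c l false}) ?_ (Set.toFinite _)).trans
        (Set.ncard_singleton _).le
      rintro _ ⟨p, rfl⟩
      rfl
  refine (Finset.sum_le_sum hle).trans ?_
  rw [Finset.sum_add_distrib, Finset.sum_ite]
  have hcard : ((Finset.range j).filter (· < i)).card ≤ i := by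
    refine (Finset.card_le_card fun l hl => ?_).trans (Finset.card_range i).le
    exact Finset.mem_range.2 (Finset.mem_filter.1 hl).2
  have := Nat.mul_le_mul_right n hcard
  simp only [Finset.sum_const, smul_eq_mul, Finset.card_range, mul_one, mul_zero, add_zero]
  omega

/-- Subshifts of complexity arbitrarily close to the lower bounds exist. -/
theorem exists_inClass_complexity_le [TopologicalSpace A] [DiscreteTopology A] [Finite A]
    {i j : ℕ} (hj : 2 ≤ j) (hij : i ≤ j) {c : ℕ → Bool → A}
    (hc : ∀ l < j, ∀ l' < j, ∀ b b', c l b = c l' b' → l = l' ∧ b = b') {g : ℕ → ℕ}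
    (hg : Monotone g) (hg' : ¬ BddAbove (Set.range g)) :
    ∃ X : Subshift A ℤ, InClass j i X ∧
      (∀ n, complexity X n ≤ (j + i + 1) * n + g n + j) ∧
      ∃ᶠ n in atTop, complexity X n ≤ (j + i) * n + g n + j := by
  choose L hL hLsymm using exists_symm_length_sturmian irrational_sqrt_two
  have hG : ∀ b, ∃ N, b ≤ g N := by
    intro b
    obtain ⟨_, ⟨N, rfl⟩, h⟩ := not_bddAbove_iff.1 hg' b
    exact ⟨N, h.le⟩
  choose G hG using hG
  have hsturm : ∀ l < i, component i c l = c l ∘ sturmian √2 := fun l hl => if_pos hl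
  have hconst : ∀ l, i ≤ l → component i c l = fun _ => c l false :=
    fun l hl => if_neg (by omega)
  obtain ⟨ℓ, t, ω, W, H, hℓ⟩ := exists_isTower hj (component i c)
    -- The run is an admissible symmetric length, long enough for the tower and for `g` to exceed `2
    -- * t K` at `ℓ K`.
    (fun K t => L (max (t + 2 * K + 1) (G (2 * t))))
    (fun K t => (le_max_left _ _).trans (hL _)) (by
      intro K t l _ p h0 h1
      rcases Nat.lt_or_ge l i with h | h
      · rw [hsturm l h]
        exact congrArg (c l) (hLsymm _ p h0 h1)
      · rw [hconst l h])
  have hgt : ∀ K, 2 * t K ≤ g (ℓ K) := by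
    intro K
    refine (hG _).trans (hg ?_)
    rw [hℓ]
    exact (le_max_right _ _).trans (hL _)
  refine ⟨orbitSubshift (glueInf (component i c) W (j - 1)), H.inClass ?_ ?_ hij ?_ ?_, ?_, ?_⟩
  · intro l _
    rcases Nat.lt_or_ge l i with h | h
    · rw [hsturm l h]
      exact (isUniformlyRecurrent_sturmian irrational_sqrt_two).comp _
    · rw [hconst l h]
      exact isUniformlyRecurrent_const _
  · intro l hl l' hl' hne p q e
    have hval : ∀ l p, ∃ b, component i c l p = c l b := by
      intro l p
      rcases Nat.lt_or_ge l i with h | h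
      · rw [hsturm l h]; exact ⟨_, rfl⟩
      · rw [hconst l h]; exact ⟨_, rfl⟩
    obtain ⟨b, hb⟩ := hval l p
    obtain ⟨b', hb'⟩ := hval l' q
    rw [hb, hb'] at e
    exact hne (hc l hl l' hl' b b' e).1
  · intro l hl
    rw [hsturm l hl]
    refine infinite_orbitSubshift fun p hp => ?_
    obtain ⟨q, hq⟩ := exists_sturmian_add_ne irrational_sqrt_two hp
    exact ⟨q, fun e => hq (hc l (by omega) l (by omega) _ _ e).2⟩
  · intro l _ hil
    rw [hconst l hil]
    exact finite_orbitSubshift_const _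
  · intro n
    have h1 := H.complexity_le hg hgt n
    have h2 := ncard_pureWords_component_le (i := i) (j := j) c n
    linarith
  · refine (H.complexity_le_frequently hgt).mono fun n h1 => ?_
    have h2 := ncard_pureWords_component_le (i := i) (j := j) c n
    linarith

section Bounds

variable [TopologicalSpace A]

theorem not_limsupBound {X : Subshift A ℤ} {f : ℕ → ℝ} {b : ℝ}
    (h : ∀ n, (complexity X n : ℝ) ≤ f n + b) : ¬ LimsupBound X f := by
  intro htop
  have : limsup (fun n : ℕ => (((complexity X n : ℝ) - f n : ℝ) : EReal)) atTop ≤ (b : EReal) :=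
    limsup_le_of_le (h := Eventually.of_forall fun n => EReal.coe_le_coe_iff.2 (by linarith [h n]))
  rw [htop] at this
  exact EReal.coe_ne_top b (top_le_iff.1 this)

theorem not_liminfBound {X : Subshift A ℤ} {f : ℕ → ℝ} {b : ℝ}
    (h : ∃ᶠ n in atTop, (complexity X n : ℝ) ≤ f n + b) : ¬ LiminfBound X f := by
  intro htop
  have : liminf (fun n : ℕ => (((complexity X n : ℝ) - f n : ℝ) : EReal)) atTop ≤ (b : EReal) :=
    liminf_le_of_frequently_le' (h.mono fun n hn => EReal.coe_le_coe_iff.2 (by linarith))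
  rw [htop] at this
  exact EReal.coe_ne_top b (top_le_iff.1 this)

end Bounds

/-- Pairwise distinct letters `(l, b)`, for `l < j`. -/
def letter (j : ℕ) [NeZero (2 * j)] (l : ℕ) (b : Bool) : Fin (2 * j) :=
  Fin.ofNat (2 * j) (2 * l + b.toNat)

theorem letter_injective {j : ℕ} [NeZero (2 * j)] {l l' : ℕ} (hl : l < j) (hl' : l' < j)
    {b b' : Bool} (h : letter j l b = letter j l' b') : l = l' ∧ b = b' := by
  have hb := Bool.toNat_lt b
  have hb' := Bool.toNat_lt b'
  have := congrArg Fin.val h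
  simp only [letter, Fin.ofNat] at this
  rw [Nat.mod_eq_of_lt (by omega), Nat.mod_eq_of_lt (by omega)] at this
  exact ⟨by omega, by cases b <;> cases b' <;> simp at this ⊢ <;> omega⟩

end SubshiftComplexity

end

theorem theorem1p1 (j i : ℕ) (hj : 2 ≤ j) (hij : i ≤ j) :
    (∀ (A : Type*) [Finite A] [TopologicalSpace A] [DiscreteTopology A] (X : Subshift A ℤ),
      SubshiftComplexity.InClass j i X →
        SubshiftComplexity.LimsupBound X (fun n : ℕ => ((j : ℝ) + i + 1) * n) ∧
        SubshiftComplexity.LiminfBound X (fun n : ℕ => ((j : ℝ) + i) * n)) ∧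
    (∀ g : ℕ → ℕ, Monotone g → ¬ BddAbove (Set.range g) →
      (∃ (m : ℕ) (X : Subshift (Fin m) ℤ), SubshiftComplexity.InClass j i X ∧
        ¬ SubshiftComplexity.LimsupBound X (fun n : ℕ => ((j : ℝ) + i + 1) * n + g n)) ∧
      (∃ (m : ℕ) (X : Subshift (Fin m) ℤ), SubshiftComplexity.InClass j i X ∧
        ¬ SubshiftComplexity.LiminfBound X (fun n : ℕ => ((j : ℝ) + i) * n + g n))) := by
  refine ⟨fun A _ _ _ X hX => hX.limsupBound_and_liminfBound hj, fun g hg hg' => ?_⟩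
  have : NeZero (2 * j) := ⟨by omega⟩
  obtain ⟨X, hX, h1, h2⟩ := SubshiftComplexity.exists_inClass_complexity_le hj hij
    (c := SubshiftComplexity.letter j)
    (fun l hl l' hl' b b' => SubshiftComplexity.letter_injective hl hl') hg hg'
  refine ⟨⟨2 * j, X, hX, SubshiftComplexity.not_limsupBound (b := j) fun n => ?_⟩,
    ⟨2 * j, X, hX, SubshiftComplexity.not_liminfBound (b := j) (h2.mono fun n hn => ?_)⟩⟩
  · exact_mod_cast h1 n
  · exact_mod_cast hn
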